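/- Let $(W,S)$ be a Coxeter system with Coxeter matrix $m:S\times S\to\{1,2,\dots,\infty\}$, identity $e$ and length function $\ell$, and let $J\subseteq S$. Let $W^J$ be the set of $w\in W$ such that no reduced expression of $w$ ends (on the right) in an element of $J$, ordered by the restriction of the Bruhat order of $W$, and write $\vartriangleleft$ for the covering relation of the poset $W^J$. An element $w\in W^J$ is called *chainlike* if it covers exactly one element $w'$ of $W^J$ and $w'$ is either $e$ or, recursively, chainlike. For $k\ge 0$, say that $s_k\cdots s_1s_0$ is *simple* if $s_0,\dots,s_k\in S$ are distinct, $s_0\in S\setminus J$, $s_1,\dots,s_k\in J$, and for all $i,j\in\{0,\dots,k\}$ one has $m(s_i,s_j)\ge 3$ if and only if $|i-j|=1$. **Theorem.** An element $w\in W$ lies in $W^J$ and is chainlike if and only if there are $k\ge0$ and $s_0,\dots,s_k\in S$ such that $s_k\cdots s_0$ is simple and $w$ has one of the following forms: - (I) $w=s_k\cdots s_0$; - (II) $w=s_ls_{l+1}\cdots s_{k-1}s_ks_{k-1}\cdots s_0$ with $0\le l<k$, $m(s_k,s_{k-1})\ge4$, and $m(s_i,s_{i+1})=3$ for $l\le i<k-1$;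 - (III) $w=\underbrace{\cdots s_{k-1}s_ks_{k-1}s_ks_{k-1}}_{m\text{ terms}}\,s_{k-2}\cdots s_0$ with $k\ge1$ and $4\le m<m(s_k,s_{k-1})$ (the word alternates between $s_k$ and $s_{k-1}$ and ends in $s_{k-1}$; the part $s_{k-2}\cdots s_0$ is empty if $k=1$). Moreover, in each case the displayed expression is the unique reduced expression of $w$. (In particular, form (I) shows that every simple $s_k\cdots s_0$ lies in $W^J$ and is chainlike.) -/

import Mathlib

/-- The entry `m(i, j)` of a Coxeter matrix as an element of `{1, 2, …, ∞}`
(Mathlib encodes the entry `∞` as `0`). -/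
def CoxeterMatrix.label {B : Type*} (M : CoxeterMatrix B) (i j : B) : ℕ∞ :=
  if M i j = 0 then ⊤ else (M i j : ℕ∞)

namespace CoxeterSystem

variable {B W : Type*} [Group W] {M : CoxeterMatrix B}

/-- One step up in the Bruhat order: `v = u * t` for a reflection `t`, and `ℓ(u) < ℓ(v)`. -/
def BruhatStep (cs : CoxeterSystem M W) (u v : W) : Prop :=
  ∃ t : W, cs.IsReflection t ∧ v = u * t ∧ cs.length u < cs.length v

/-- The Bruhat order on `W`: `u ≤ v` if `v` is reached from `u` by finitely many
(possibly zero) steps up. -/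
def BruhatLE (cs : CoxeterSystem M W) : W → W → Prop :=
  Relation.ReflTransGen cs.BruhatStep

theorem BruhatLE.eq_or_length_lt {cs : CoxeterSystem M W} {u v : W} (h : cs.BruhatLE u v) :
    u = v ∨ cs.length u < cs.length v := by
  induction h with
  | refl => exact Or.inl rfl
  | tail _ hs ih =>
    obtain ⟨t, _, _, hl⟩ := hs
    rcases ih with rfl | ih
    · exact Or.inr hl
    · exact Or.inr (ih.trans hl)

/-- The set `W^J`: the rightmost generator of every reduced expression of `w` is not in `J`. -/
def minCosetReps (cs : CoxeterSystem M W) (J : Set B) : Set W :=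
  {w | ∀ (ω : List B) (j : B), cs.IsReduced (ω ++ [j]) → cs.wordProd (ω ++ [j]) = w → j ∉ J}

/-- The poset `W^J`, with the Bruhat order of `W` restricted to it. -/
structure ParabolicQuotient (cs : CoxeterSystem M W) (J : Set B) where
  val : W
  mem : val ∈ cs.minCosetReps J

namespace ParabolicQuotient

variable {cs : CoxeterSystem M W} {J : Set B}

instance : PartialOrder (ParabolicQuotient cs J) where
  le u v := cs.BruhatLE u.val v.val
  le_refl _ := Relation.ReflTransGen.refl
  le_trans _ _ _ := Relation.ReflTransGen.trans
  le_antisymm u v huv hvu := by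
    rcases u with ⟨u, hu⟩
    rcases v with ⟨v, hv⟩
    rcases BruhatLE.eq_or_length_lt huv with h | h
    · dsimp at h
      subst h
      rfl
    · rcases BruhatLE.eq_or_length_lt hvu with h' | h'
      · dsimp at h'
        subst h'
        rfl
      · exact absurd h (lt_asymm h')

/-- The identity element `e` of `W`, as an element of `W^J`. -/
instance : One (ParabolicQuotient cs J) where
  one := ⟨1, by
    intro ω j hω h1
    have h : cs.length (cs.wordProd (ω ++ [j])) = (ω ++ [j]).length := hω
    rw [h1, cs.length_one] at h
    simp at h⟩

/-- `w'` is the one and only element of `W^J` that `w` covers (in the poset `W^J`). -/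
def CoversOnly (w w' : ParabolicQuotient cs J) : Prop :=
  ∀ u : ParabolicQuotient cs J, u ⋖ w ↔ u = w'

/-- Chainlike elements of `W^J`: `w` covers exactly one element `w'` of `W^J`, and `w'` is
either `e` or chainlike. -/
inductive IsChainlike : ParabolicQuotient cs J → Prop
  | base (w : ParabolicQuotient cs J) : CoversOnly w 1 → IsChainlike w
  | step (w w' : ParabolicQuotient cs J) : CoversOnly w w' → IsChainlike w' → IsChainlike w

end ParabolicQuotient

/-- The set `C(W^J)` of the chainlike elements of `W^J`, as a subset of `W`. -/
def chainlikes (cs : CoxeterSystem M W) (J : Set B) : Set W :=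
  {w | ∃ hw : w ∈ cs.minCosetReps J,
    ParabolicQuotient.IsChainlike (⟨w, hw⟩ : ParabolicQuotient cs J)}

end CoxeterSystem

namespace CoxeterMatrix

variable {B : Type*}

/-- The generators `s 0, …, s k` (later values of `s` are irrelevant) satisfy the conditions
under which the product `s k ⋯ s 0` is a simple element of `W^J`. -/
structure IsSimpleSeq (M : CoxeterMatrix B) (J : Set B) (s : ℕ → B) (k : ℕ) : Prop where
  distinct : ∀ i j : ℕ, i ≤ k → j ≤ k → s i = s j → i = j
  zero_notMem : s 0 ∉ J
  mem : ∀ i : ℕ, 1 ≤ i → i ≤ k → s i ∈ J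
  edge_iff : ∀ i j : ℕ, i ≤ k → j ≤ k → (3 ≤ M.label (s i) (s j) ↔ (i + 1 = j ∨ j + 1 = i))

/-- The word `s (n - 1), …, s 1, s 0` of length `n`. -/
def descWord (s : ℕ → B) (n : ℕ) : List B := ((List.range n).map s).reverse

/-- Form (I): the word `s k, …, s 0`. -/
def IsFormI (s : ℕ → B) (k : ℕ) (ω : List B) : Prop :=
  ω = descWord s (k + 1)

/-- Form (II): the word `s l, s (l + 1), …, s (k - 1), s k, s (k - 1), …, s 0`, where `l < k`,
`m(s k, s (k - 1)) ≥ 4`, and `m(s i, s (i + 1)) = 3` for `l ≤ i < k - 1`. -/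
def IsFormII (M : CoxeterMatrix B) (s : ℕ → B) (k : ℕ) (ω : List B) : Prop :=
  ∃ l : ℕ, l < k ∧ 4 ≤ M.label (s k) (s (k - 1)) ∧
    (∀ i : ℕ, l ≤ i → i + 1 < k → M.label (s i) (s (i + 1)) = 3) ∧
    ω = (List.range' l (k - l)).map s ++ descWord s (k + 1)

/-- Form (III): the word of length `m` that alternates between `s k` and `s (k - 1)` and ends
with `s (k - 1)`, followed by `s (k - 2), …, s 0` (nothing if `k = 1`), where `k ≥ 1` and
`4 ≤ m < m(s k, s (k - 1))`. -/
def IsFormIII (M : CoxeterMatrix B) (s : ℕ → B) (k : ℕ) (ω : List B) : Prop :=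
  ∃ m : ℕ, 1 ≤ k ∧ 4 ≤ m ∧ (m : ℕ∞) < M.label (s k) (s (k - 1)) ∧
    ω = CoxeterSystem.alternatingWord (s k) (s (k - 1)) m ++ descWord s (k - 1)

/-- `ω` is a word of one of the three forms, built on generators `s 0, …, s k` for which
`s k ⋯ s 0` is simple. -/
def IsFormWord (M : CoxeterMatrix B) (J : Set B) (ω : List B) : Prop :=
  ∃ (k : ℕ) (s : ℕ → B), M.IsSimpleSeq J s k ∧
    (IsFormI s k ω ∨ M.IsFormII s k ω ∨ M.IsFormIII s k ω)

end CoxeterMatrix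

/-! A left descent of an element of `W^J` leads down inside `W^J`. So an element with a single lower
cover arises from that cover by prepending one generator, and chainlike elements are grown letter by
letter on the left. By Deodhar's lemma, for `w` in `W^J` the product `s_i w` stays in `W^J` unless
`s_i w = w s_j` with `j ∈ J`, that is, unless `w` absorbs `i`. Suppose the suffixes of a word
already represent everything in `W^J` below its product. By the lifting property of the Bruhat
order, prepending `i` keeps a single lower cover exactly when, for every proper suffix, `i` is its
head, or is absorbed by it, or extends it to another suffix. This is `IsChainWord`.
`IsChainWord.spec` gives the lower ideal and the uniqueness of the reduced word together, and
`mem_chainlikes_iff` identifies the chainlike elements. What remains is to decide absorption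
(`IsUniquelyReduced.exists_of_absorbs`). If `v` absorbs `i` and its word starts with `a ≠ i`, then
`i` and `a` are both left descents of `s_i v`, which therefore starts with a full side of the braid
relation. When `v` has only one reduced word, that word must visibly start with an alternating word
of length `m(i,a) - 1`. Hence commuting letters are transparent, label 3 needs the pattern `a i`,
and larger labels need at least `a i a`. These local tests verify the chain condition for the three
forms. They also show that prepending a letter to one of the forms gives one of the forms again. Two
general facts support this. The order of `s_i s_j` is exactly `m(i,j)`, by the geometric
representation. Strong exchange holds, by the signed conjugation action. -/

/-! ### The geometric representation and the exact order of a product of two generators. -/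

-- With `θ = 2π/m` one has `S_n(2 cos θ) = sin((n+1)θ) / sin θ`. For `m = 2k` the factor `S_{k-1}`
-- vanishes because `sin π = 0`. For `m = 2k+1` the sum `S_k + S_{k-1}` vanishes by `sin (2π - x) =
-- -sin x`. These products are the coefficients in the formula for the `m`-th power of a product of
-- two reflections.
open Polynomial.Chebyshev in
theorem Real.chebyshevS_coeffs_eq_zero {m : ℕ} (hm : 3 ≤ m) {t : ℝ}
    (ht : t = 2 * Real.cos (2 * Real.pi / m)) :
    (S ℝ (((m : ℤ) - 2) / 2)).eval t *
      ((S ℝ (((m : ℤ) - 1) / 2)).eval t + (S ℝ (((m : ℤ) - 3) / 2)).eval t) = 0 ∧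
    (S ℝ (((m : ℤ) - 1) / 2)).eval t *
      ((S ℝ ((m : ℤ) / 2)).eval t + (S ℝ (((m : ℤ) - 2) / 2)).eval t) = 0 := by
  set θ : ℝ := 2 * Real.pi / m with hθ
  have hm0 : (m : ℝ) ≠ 0 := by positivity
  have hm3 : (3 : ℝ) ≤ m := by exact_mod_cast hm
  have hsin : Real.sin θ ≠ 0 := by
    apply ne_of_gt
    apply Real.sin_pos_of_pos_of_lt_pi
    · positivity
    · rw [hθ, div_lt_iff₀ (by positivity)]
      nlinarith [Real.pi_pos]
  have hmθ : (m : ℝ) * θ = 2 * Real.pi := by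
    rw [hθ]
    field_simp
  have hS (n : ℤ) : (S ℝ n).eval t = Real.sin ((n + 1) * θ) / Real.sin θ := by
    rw [eq_div_iff hsin, ht, S_two_mul_real_cos]
  rcases Nat.even_or_odd' m with ⟨k, hk | hk⟩
  · have h1 : ((m : ℤ) - 2) / 2 = k - 1 := by lia
    have h2 : ((m : ℤ) - 1) / 2 = k - 1 := by lia
    have hz : (S ℝ ((k : ℤ) - 1)).eval t = 0 := by
      rw [hS]
      have : ((((k : ℤ) - 1 : ℤ) : ℝ) + 1) * θ = Real.pi := by
        push_cast
        rw [hk] at hmθ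
        push_cast at hmθ
        linarith
      rw [this, Real.sin_pi, zero_div]
    rw [h1, h2, hz]
    simp
  · have h1 : ((m : ℤ) - 1) / 2 = k := by lia
    have h2 : ((m : ℤ) - 3) / 2 = k - 1 := by lia
    have h3 : ((m : ℤ) - 2) / 2 = k - 1 := by lia
    have h4 : (m : ℤ) / 2 = k := by lia
    have hz : (S ℝ (k : ℤ)).eval t + (S ℝ ((k : ℤ) - 1)).eval t = 0 := by
      rw [hS, hS, ← add_div]
      have : (((k : ℤ) : ℝ) + 1) * θ = 2 * Real.pi - ((((k : ℤ) - 1 : ℤ) : ℝ) + 1) * θ := by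
        rw [hk] at hmθ
        push_cast at hmθ ⊢
        linarith
      rw [this, Real.sin_two_pi_sub]
      simp
    rw [h1, h2, h3, h4, hz]
    simp

namespace CoxeterMatrix

variable {B : Type*} (M : CoxeterMatrix B)

/-- The simple coroot of `i`, as a linear form on the space of the geometric representation. -/
noncomputable def coroot (i : B) : Module.Dual ℝ (B →₀ ℝ) :=
  Finsupp.linearCombination ℝ (fun j => -2 * Real.cos (Real.pi / M i j))

theorem coroot_single (i j : B) :
    M.coroot i (Finsupp.single j 1) = -2 * Real.cos (Real.pi / M i j) := by
  simp [coroot]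

theorem coroot_single_self (i : B) : M.coroot i (Finsupp.single i 1) = 2 := by
  simp [coroot_single]

/-- The reflection of the geometric representation attached to `i`. -/
noncomputable def geometricReflection (i : B) : (B →₀ ℝ) ≃ₗ[ℝ] (B →₀ ℝ) :=
  Module.reflection (M.coroot_single_self i)

theorem coroot_mul_coroot_sub_two (i j : B) :
    M.coroot i (Finsupp.single j 1) * M.coroot j (Finsupp.single i 1) - 2 =
      2 * Real.cos (2 * Real.pi / M i j) := by
  rw [coroot_single, coroot_single, M.symmetric j i, mul_div_assoc, Real.cos_two_mul]
  ring

theorem isLiftable_geometricReflection : M.IsLiftable M.geometricReflection := by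
  intro i j
  -- The Chebyshev argument divides by `sin (2π/m)`, so the entries 0 (meaning `∞`), 1 and 2 are
  -- treated directly.
  rcases Nat.lt_or_ge (M i j) 3 with h | h
  · have h3 : M i j = 0 ∨ M i j = 1 ∨ M i j = 2 := by lia
    rcases h3 with h0 | h1 | h2
    · rw [h0, pow_zero]
    · have hij : i = j := by
        by_contra hne
        exact M.off_diagonal i j hne h1
      subst hij
      rw [h1, pow_one]
      exact LinearEquiv.ext fun z =>
        Module.involutive_reflection (M.coroot_single_self i) z
    · have hij : M.coroot i (Finsupp.single j 1) = 0 := by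
        rw [coroot_single, h2]
        simp
      have hji : M.coroot j (Finsupp.single i 1) = 0 := by
        rw [coroot_single, M.symmetric, h2]
        simp
      rw [h2]
      apply LinearEquiv.ext
      intro z
      simp only [pow_two, LinearEquiv.mul_apply, geometricReflection, Module.reflection_apply,
        map_sub, map_smul, hij, hji, coroot_single_self, LinearEquiv.coe_one, id]
      module
  · obtain ⟨h1, h2⟩ := Real.chebyshevS_coeffs_eq_zero h (M.coroot_mul_coroot_sub_two i j)
    apply LinearEquiv.ext
    intro z
    rw [geometricReflection, geometricReflection, Module.reflection_mul_reflection_pow_apply, h1, h2]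
    simp

end CoxeterMatrix

namespace CoxeterSystem

variable {B W : Type*} [Group W] {M : CoxeterMatrix B} (cs : CoxeterSystem M W)

-- Apply the power to the basis vector of `i` and compare coordinates. For label `∞` the coordinate
-- at `j` is governed by `S_{n-1}(2) = n ≠ 0`. For finite label at least 3 that coordinate gives
-- `S_{n-1} = 0`, the one at `i` then gives `S_n = 1`, so `cos nθ = 1` and the label divides `n`.
open Polynomial.Chebyshev in
theorem label_le_of_simple_mul_simple_pow_eq_one {i j : B} {n : ℕ} (hn : 0 < n)
    (h : (cs.simple i * cs.simple j) ^ n = 1) : M i j ≠ 0 ∧ M i j ≤ n := by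
  by_cases hij : i = j
  · subst hij
    simp only [M.diagonal]
    lia
  have h1 := congrArg (cs.lift ⟨_, M.isLiftable_geometricReflection⟩) h
  simp only [map_pow, map_mul, lift_apply_simple, map_one] at h1
  have h2 := congrArg (fun e : (B →₀ ℝ) ≃ₗ[ℝ] (B →₀ ℝ) => e (Finsupp.single i 1)) h1
  simp only [CoxeterMatrix.geometricReflection] at h2
  rw [Module.reflection_mul_reflection_pow_apply_self _ _ n
    (2 * Real.cos (2 * Real.pi / M i j)) (M.coroot_mul_coroot_sub_two i j).symm] at h2
  set t : ℝ := 2 * Real.cos (2 * Real.pi / M i j) with ht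
  have hx := DFunLike.congr_fun h2 i
  have hy := DFunLike.congr_fun h2 j
  have hji : j ≠ i := fun h => hij h.symm
  simp [hij, hji, M.coroot_single, M.symmetric j i] at hx hy
  by_contra hcon
  have hm1 : M i j ≠ 1 := M.off_diagonal i j hij
  rcases eq_or_ne (M i j) 0 with h0 | h0
  · rw [h0] at ht hy
    simp at ht hy
    rw [ht, S_eval_two] at hy
    push_cast at hy
    have : (n : ℝ) = 0 := by linarith
    norm_cast at this
    lia
  · have hlt : n < M i j := by
      by_contra hle
      exact hcon ⟨h0, by lia⟩
    rcases eq_or_ne (M i j) 2 with h2' | h2'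
    · have hn1 : n = 1 := by lia
      subst hn1
      rw [h2'] at ht
      have : t = -2 := by
        rw [ht]
        norm_num [mul_div_assoc]
      rw [this] at hx
      norm_num at hx
    · have hm3 : 3 ≤ M i j := by lia
      have hm3' : (3 : ℝ) ≤ M i j := by exact_mod_cast hm3
      set θ : ℝ := 2 * Real.pi / M i j with hθ
      have hsin : 0 < Real.sin θ := by
        apply Real.sin_pos_of_pos_of_lt_pi
        · positivity
        · rw [hθ, div_lt_iff₀ (by positivity)]
          nlinarith [Real.pi_pos]
      have hcos : Real.cos (Real.pi / M i j) ≠ 0 := by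
        apply ne_of_gt
        apply Real.cos_pos_of_mem_Ioo
        constructor
        · have : 0 < Real.pi / M i j := by positivity
          linarith [Real.pi_pos]
        · rw [div_lt_div_iff₀ (by positivity) (by norm_num)]
          nlinarith [Real.pi_pos]
      have hy' : (S ℝ ((n : ℤ) - 1)).eval t = 0 := by
        rcases hy with h | h
        · exact h
        · exact absurd h hcos
      rw [hy', add_zero] at hx
      have e1 := S_two_mul_real_cos θ n
      have e2 := S_two_mul_real_cos θ ((n : ℤ) - 1)
      rw [← ht, hx, one_mul] at e1
      rw [← ht, hy', zero_mul] at e2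
      push_cast at e1 e2
      rw [add_mul, one_mul, Real.sin_add] at e1
      rw [sub_add_cancel] at e2
      rw [← e2, zero_mul, zero_add] at e1
      have hc : Real.cos (n * θ) = 1 := by
        have : (Real.cos (n * θ) - 1) * Real.sin θ = 0 := by linarith
        rcases mul_eq_zero.1 this with h | h
        · linarith
        · exact absurd h hsin.ne'
      obtain ⟨z, hz⟩ := (Real.cos_eq_one_iff _).1 hc
      have hzm : (z : ℝ) * M i j = n := by
        rw [hθ] at hz
        have hp := Real.pi_pos
        field_simp at hz
        exact hz
      have hzm' : z * (M i j : ℤ) = n := by exact_mod_cast hzm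
      have hz0 : 0 < z := by
        by_contra hz0
        have : z * (M i j : ℤ) ≤ 0 := by
          apply mul_nonpos_of_nonpos_of_nonneg <;> lia
        lia
      have : (M i j : ℤ) ≤ z * (M i j : ℤ) := by nlinarith
      lia

theorem simple_injective : Function.Injective cs.simple := by
  intro i j h
  by_contra hij
  have := cs.label_le_of_simple_mul_simple_pow_eq_one (i := i) (j := j) one_pos (by simp [h])
  exact M.off_diagonal i j hij (by lia)

end CoxeterSystem

/-! ### The signed conjugation action and strong exchange. -/

theorem Function.End.mul_apply_eq {α : Type*} (f g : Function.End α) (x : α) :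
    (f * g) x = f (g x) := rfl

namespace CoxeterSystem

variable {B W : Type*} [Group W] {M : CoxeterMatrix B} (cs : CoxeterSystem M W)

open Classical in
/-- The action of a simple reflection on signed group elements: conjugation, together with a
change of sign of the reflection itself. -/
noncomputable def signedConj (i : B) : Function.End (W × ZMod 2) := fun p =>
  (cs.simple i * p.1 * cs.simple i, p.2 + if p.1 = cs.simple i then 1 else 0)

open Classical in
theorem prod_map_signedConj (ω : List B) (t : W) (ε : ZMod 2) :
    (ω.map cs.signedConj).prod (t, ε) =
      (cs.wordProd ω * t * (cs.wordProd ω)⁻¹, ε + ((cs.rightInvSeq ω).count t : ℕ)) := by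
  induction ω with
  | nil =>
    simp only [List.map_nil, List.prod_nil, wordProd_nil, rightInvSeq_nil, List.count_nil]
    simp [Function.End.one_def]
  | cons i ω ih =>
    rw [List.map_cons, List.prod_cons, Function.End.mul_apply_eq, ih]
    simp only [signedConj, wordProd_cons, rightInvSeq, List.count_cons, mul_inv_rev, inv_simple,
      mul_assoc, Prod.mk.injEq, true_and]
    have : (cs.wordProd ω * (t * (cs.wordProd ω)⁻¹) = cs.simple i) ↔
        (((cs.wordProd ω)⁻¹ * (cs.simple i * cs.wordProd ω)) == t) = true := by
      rw [beq_iff_eq, inv_mul_eq_iff_eq_mul, ← mul_assoc, mul_inv_eq_iff_eq_mul, eq_comm]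
    simp only [this]
    push_cast
    ring

/-- The inversion sequence of a word for `(s_i s_j)^m` runs twice through the same `m` terms, so the
signs cancel. This is what makes the signed action respect the Coxeter relations. -/
theorem count_rightInvSeq_alternatingWord [DecidableEq W] (i j : B) (t : W) :
    Even ((cs.rightInvSeq (alternatingWord i j (2 * M i j))).count t) := by
  have hrev : cs.rightInvSeq (alternatingWord i j (2 * M i j)) =
      (cs.leftInvSeq (alternatingWord i j (2 * M i j)).reverse).reverse := by
    rw [← rightInvSeq_reverse, List.reverse_reverse]
  have hword : (alternatingWord i j (2 * M i j)).reverse = alternatingWord j i (2 * M i j) := by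
    apply List.ext_getElem
    · simp
    · intro n h1 h2
      simp only [List.length_reverse, length_alternatingWord] at h1
      rw [List.getElem_reverse, getElem_alternatingWord _ _ _ _ h1]
      rw [getElem_alternatingWord _ _ _ _ (by simp; lia)]
      simp only [length_alternatingWord]
      have h3 : Even (2 * M i j + (2 * M i j - 1 - n)) ↔ ¬ Even (2 * M i j + n) := by
        simp only [Nat.even_iff]
        lia
      by_cases h4 : Even (2 * M i j + n) <;> simp [h3, h4]
  rw [hrev, hword, List.count_reverse]
  set l := cs.leftInvSeq (alternatingWord j i (2 * M i j)) with hl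
  have hlen : l.length = 2 * M i j := by simp [hl]
  have hdrop : l.drop (M i j) = l.take (M i j) := by
    apply List.ext_getElem
    · simp [hlen]
      lia
    · intro n h1 h2
      have hn : n < M i j := by
        simp only [List.length_take] at h2
        lia
      rw [List.getElem_drop, List.getElem_take]
      simp only [hl]
      rw [getElem_leftInvSeq_alternatingWord _ _ _ _ _ (by lia),
        getElem_leftInvSeq_alternatingWord _ _ _ _ _ (by lia)]
      rw [prod_alternatingWord_eq_mul_pow, prod_alternatingWord_eq_mul_pow]
      have e1 : (2 * (M i j + n) + 1) / 2 = M i j + n := by lia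
      have e2 : (2 * n + 1) / 2 = n := by lia
      rw [e1, e2, pow_add, simple_mul_simple_pow, one_mul]
      simp
  rw [← List.take_append_drop (M i j) l, List.count_append, hdrop]
  exact ⟨_, rfl⟩

theorem isLiftable_signedConj : M.IsLiftable cs.signedConj := by
  classical
  intro i j
  have hprod : (cs.signedConj i * cs.signedConj j) ^ M i j =
      ((alternatingWord i j (2 * M i j)).map cs.signedConj).prod := by
    generalize M i j = m
    induction m with
    | zero => simp [alternatingWord]
    | succ m ih =>
      rw [pow_succ, ih, mul_add, mul_one]
      have : alternatingWord i j (2 * m + 2) = alternatingWord i j (2 * m) ++ [i, j] := by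
        rw [alternatingWord_succ, alternatingWord_succ]
        simp
      rw [this]
      simp
  rw [hprod]
  funext ⟨t, ε⟩
  rw [prod_map_signedConj]
  have h1 : cs.wordProd (alternatingWord i j (2 * M i j)) = 1 := by
    rw [prod_alternatingWord_eq_mul_pow]
    simp
  have h2 := (ZMod.natCast_eq_zero_iff_even).2 (cs.count_rightInvSeq_alternatingWord i j t)
  rw [h1, h2]
  simp [Function.End.one_def]

/-- The action of `W` on signed group elements. -/
noncomputable def signedAction : W →* Function.End (W × ZMod 2) :=
  cs.lift ⟨_, cs.isLiftable_signedConj⟩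

/-- The parity of the number of occurrences of `t` in a right inversion sequence of `w`. -/
noncomputable def inversionParity (w t : W) : ZMod 2 := (cs.signedAction w (t, 0)).2

theorem signedAction_wordProd (ω : List B) :
    cs.signedAction (cs.wordProd ω) = (ω.map cs.signedConj).prod := by
  rw [wordProd, map_list_prod, List.map_map]
  congr 1
  apply List.map_congr_left
  intro i _
  exact cs.lift_apply_simple cs.isLiftable_signedConj i

open Classical in
theorem inversionParity_wordProd (ω : List B) (t : W) :
    cs.inversionParity (cs.wordProd ω) t = ((cs.rightInvSeq ω).count t : ℕ) := by
  rw [inversionParity, signedAction_wordProd, prod_map_signedConj, zero_add]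

theorem inversionParity_one (t : W) : cs.inversionParity 1 t = 0 := by
  classical
  rw [← cs.wordProd_nil, inversionParity_wordProd]
  simp

theorem signedAction_apply (w t : W) (ε : ZMod 2) :
    cs.signedAction w (t, ε) = (w * t * w⁻¹, ε + cs.inversionParity w t) := by
  obtain ⟨ω, rfl⟩ := cs.wordProd_surjective w
  rw [inversionParity, signedAction_wordProd, prod_map_signedConj, prod_map_signedConj, zero_add]

theorem inversionParity_mul (u v t : W) :
    cs.inversionParity (u * v) t =
      cs.inversionParity v t + cs.inversionParity u (v * t * v⁻¹) := by
  rw [inversionParity, map_mul, Function.End.mul_apply_eq, signedAction_apply,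
    signedAction_apply, zero_add]

open Classical in
theorem inversionParity_simple (i : B) (t : W) :
    cs.inversionParity (cs.simple i) t = if t = cs.simple i then 1 else 0 := by
  have := cs.inversionParity_wordProd [i] t
  rw [wordProd_singleton] at this
  rw [this, rightInvSeq_singleton, List.count_singleton]
  simp only [beq_iff_eq, @eq_comm _ _ t]
  split_ifs <;> simp

/-- Write `t = u s u⁻¹` and use the cocycle rule. The contributions of `u` and `u⁻¹` cancel, since
they add up to the parity of `u⁻¹ u = 1`, and only the sign change of `s` on itself is left. -/
theorem IsReflection.inversionParity_self {t : W} (ht : cs.IsReflection t) :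
    cs.inversionParity t t = 1 := by
  obtain ⟨u, i, rfl⟩ := ht
  have h := cs.inversionParity_mul u⁻¹ u (cs.simple i)
  rw [inv_mul_cancel, inversionParity_one] at h
  rw [inversionParity_mul, inversionParity_mul]
  have e1 : u⁻¹ * (u * cs.simple i * u⁻¹) * u⁻¹⁻¹ = cs.simple i := by group
  rw [e1, inversionParity_simple, if_pos rfl, inv_simple, simple_mul_simple_self, one_mul]
  linear_combination -h

/-- Strong exchange: nonzero parity means that `t` occurs in the inversion sequence of a reduced
word. Passing from `w` to `w * t` flips the parity, so parity 0 would make `t` an inversion of `w *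
t` instead of `w`. -/
theorem isRightInversion_iff_inversionParity {w t : W} (ht : cs.IsReflection t) :
    cs.IsRightInversion w t ↔ cs.inversionParity w t = 1 := by
  classical
  have key : ∀ w : W, cs.inversionParity w t ≠ 0 → cs.IsRightInversion w t := by
    intro w hw
    obtain ⟨ω, hω, rfl⟩ := cs.exists_isReduced w
    rw [inversionParity_wordProd] at hw
    apply cs.isRightInversion_of_mem_rightInvSeq hω
    by_contra hmem
    rw [List.count_eq_zero_of_not_mem hmem] at hw
    simp at hw
  constructor
  · intro h
    by_contra h1
    have h0 : cs.inversionParity w t = 0 := by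
      generalize cs.inversionParity w t = x at h1
      fin_cases x
      · rfl
      · exact absurd rfl h1
    have h2 : cs.IsRightInversion (w * t) t := by
      apply key
      rw [inversionParity_mul, IsReflection.inversionParity_self cs ht, mul_inv_cancel_right, h0]
      simp
    have h3 := h.2
    have h4 := h2.2
    rw [mul_assoc, ht.mul_self, mul_one] at h4
    lia
  · intro h
    exact key w (by rw [h]; simp)

theorem isLeftInversion_simple_mul_conj_iff {w t : W} {i : B} (ht : cs.IsReflection t)
    (hti : t ≠ cs.simple i) :
    cs.IsLeftInversion (cs.simple i * w) (cs.simple i * t * cs.simple i) ↔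
      cs.IsLeftInversion w t := by
  have hc : cs.IsReflection (cs.simple i * t * cs.simple i) := by
    have := ht.conj (cs.simple i)
    rwa [inv_simple] at this
  have hne : cs.simple i * t * cs.simple i ≠ cs.simple i := by
    intro h
    apply hti
    have := congrArg (fun x => cs.simple i * x * cs.simple i) h
    simpa [mul_assoc] using this
  rw [← isRightInversion_inv_iff, ← isRightInversion_inv_iff,
    isRightInversion_iff_inversionParity _ hc, isRightInversion_iff_inversionParity _ ht,
    mul_inv_rev, inv_simple, inversionParity_mul, inversionParity_simple, if_neg hne, inv_simple]
  simp [mul_assoc]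

end CoxeterSystem

/-! ### The Bruhat order under left multiplication by a generator. -/

namespace CoxeterSystem

variable {B W : Type*} [Group W] {M : CoxeterMatrix B} (cs : CoxeterSystem M W)

theorem bruhatStep_simple_mul_self {w : W} {i : B} (h : cs.IsLeftDescent w i) :
    cs.BruhatStep (cs.simple i * w) w := by
  refine ⟨w⁻¹ * cs.simple i * w, ?_, ?_, h⟩
  · have := (cs.isReflection_simple i).conj w⁻¹
    rwa [inv_inv] at this
  · simp [mul_assoc]

theorem bruhatStep_self_simple_mul {w : W} {i : B} (h : ¬ cs.IsLeftDescent w i) :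
    cs.BruhatStep w (cs.simple i * w) := by
  have := cs.bruhatStep_simple_mul_self (w := cs.simple i * w) (i := i) (by
    rw [isLeftDescent_iff_not_isLeftDescent_mul]
    simpa using h)
  simpa using this

theorem BruhatStep.simple_mul {u w : W} (h : cs.BruhatStep u w) (i : B) :
    cs.simple i * u = w ∨ cs.BruhatStep (cs.simple i * u) (cs.simple i * w) := by
  obtain ⟨t, ht, rfl, hl⟩ := h
  by_cases hti : u * t * u⁻¹ = cs.simple i
  · left
    rw [← hti]
    group
  · right
    refine ⟨t, ht, by rw [mul_assoc], ?_⟩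
    have h1 : cs.IsLeftInversion (u * t) (u * t * u⁻¹) := by
      refine ⟨ht.conj u, ?_⟩
      have : u * t * u⁻¹ * (u * t) = u := by
        simp [mul_assoc, ht.mul_self]
      rwa [this]
    have h2 := ((cs.isLeftInversion_simple_mul_conj_iff (ht.conj u) hti).2 h1).2
    have : cs.simple i * (u * t * u⁻¹) * cs.simple i * (cs.simple i * (u * t)) =
        cs.simple i * u := by
      simp [mul_assoc, ht.mul_self]
    rwa [this] at h2

theorem BruhatLE.length_le {u v : W} (h : cs.BruhatLE u v) : cs.length u ≤ cs.length v := by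
  rcases h.eq_or_length_lt with rfl | h
  · exact le_rfl
  · exact h.le

open Classical in
/-- The smaller of `w` and `s i * w`. -/
noncomputable def leftLower (i : B) (w : W) : W :=
  if cs.IsLeftDescent w i then cs.simple i * w else w

open Classical in
/-- The larger of `w` and `s i * w`. -/
noncomputable def leftUpper (i : B) (w : W) : W :=
  if cs.IsLeftDescent w i then w else cs.simple i * w

/-- Half of the lifting property. Left multiplication by `s_i` preserves a step unless it swaps its
two ends, so replacing both ends by the lower members of their pairs `{x, s_i x}` is monotone. -/
theorem BruhatStep.leftLower {u w : W} (h : cs.BruhatStep u w) (i : B) :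
    cs.BruhatLE (cs.leftLower i u) (cs.leftLower i w) := by
  have hl : cs.length u < cs.length w := h.choose_spec.2.2
  unfold CoxeterSystem.leftLower
  rcases h.simple_mul cs i with h' | h'
  · have hw : cs.simple i * w = u := by rw [← h']; simp
    have h1 : cs.IsLeftDescent w i := by rwa [IsLeftDescent, hw]
    have h2 : ¬ cs.IsLeftDescent u i := by
      rw [IsLeftDescent, h']
      lia
    rw [if_neg h2, if_pos h1, hw]
    exact Relation.ReflTransGen.refl
  · split_ifs with h1 h2 h2
    · exact Relation.ReflTransGen.single h'
    · exact (Relation.ReflTransGen.single (cs.bruhatStep_simple_mul_self h1)).tail h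
    · exact (Relation.ReflTransGen.single (cs.bruhatStep_self_simple_mul h1)).tail h'
    · exact Relation.ReflTransGen.single h

theorem BruhatStep.leftUpper {u w : W} (h : cs.BruhatStep u w) (i : B) :
    cs.BruhatLE (cs.leftUpper i u) (cs.leftUpper i w) := by
  have hl : cs.length u < cs.length w := h.choose_spec.2.2
  unfold CoxeterSystem.leftUpper
  rcases h.simple_mul cs i with h' | h'
  · have hw : cs.simple i * w = u := by rw [← h']; simp
    have h1 : cs.IsLeftDescent w i := by rwa [IsLeftDescent, hw]
    have h2 : ¬ cs.IsLeftDescent u i := by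
      rw [IsLeftDescent, h']
      lia
    rw [if_neg h2, if_pos h1, h']
    exact Relation.ReflTransGen.refl
  · split_ifs with h1 h2 h2
    · exact Relation.ReflTransGen.single h
    · exact (Relation.ReflTransGen.single h).tail (cs.bruhatStep_self_simple_mul h2)
    · exact (Relation.ReflTransGen.single h').tail (cs.bruhatStep_simple_mul_self h2)
    · exact Relation.ReflTransGen.single h'

theorem BruhatLE.leftLower {u w : W} (h : cs.BruhatLE u w) (i : B) :
    cs.BruhatLE (cs.leftLower i u) (cs.leftLower i w) := by
  induction h with
  | refl => exact Relation.ReflTransGen.refl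
  | tail _ hs ih => exact ih.trans (hs.leftLower cs i)

theorem BruhatLE.leftUpper {u w : W} (h : cs.BruhatLE u w) (i : B) :
    cs.BruhatLE (cs.leftUpper i u) (cs.leftUpper i w) := by
  induction h with
  | refl => exact Relation.ReflTransGen.refl
  | tail _ hs ih => exact ih.trans (hs.leftUpper cs i)

theorem IsReduced.tail {i : B} {ω : List B} (h : cs.IsReduced (i :: ω)) : cs.IsReduced ω := by
  simpa using h.drop 1

theorem isReduced_cons_iff {i : B} {ω : List B} (hω : cs.IsReduced ω) :
    cs.IsReduced (i :: ω) ↔ ¬ cs.IsLeftDescent (cs.wordProd ω) i := by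
  rw [not_isLeftDescent_iff, IsReduced, wordProd_cons, List.length_cons, hω.eq]

theorem bruhatLE_of_isSuffix {υ ω : List B} (h : υ <:+ ω) (hω : cs.IsReduced ω) :
    cs.BruhatLE (cs.wordProd υ) (cs.wordProd ω) := by
  induction ω with
  | nil =>
    rw [List.suffix_nil.1 h]
    exact Relation.ReflTransGen.refl
  | cons i ω ih =>
    rcases List.suffix_cons_iff.1 h with rfl | h
    · exact Relation.ReflTransGen.refl
    · have hω' := IsReduced.tail cs hω
      refine (ih h hω').tail ?_
      rw [wordProd_cons]
      exact cs.bruhatStep_self_simple_mul ((cs.isReduced_cons_iff hω').1 hω)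

/-! ### Minimal coset representatives and absorption. -/

variable {J : Set B}

theorem mem_minCosetReps_iff {w : W} :
    w ∈ cs.minCosetReps J ↔ ∀ j ∈ J, ¬ cs.IsRightDescent w j := by
  constructor
  · intro h j hj hd
    obtain ⟨ω, hω, hp⟩ := cs.exists_isReduced (w * cs.simple j)
    rw [isRightDescent_iff] at hd
    have hw : cs.wordProd (ω ++ [j]) = w := by
      rw [wordProd_append, ← hp, wordProd_singleton, simple_mul_simple_cancel_right]
    refine h ω j ?_ hw hj
    rw [IsReduced, hw, List.length_append, ← hω.eq, ← hp, ← hd]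
    rfl
  · intro h ω j hω hw hj
    apply h j hj
    rw [IsRightDescent, ← hw, hω.eq, wordProd_append, wordProd_singleton,
      simple_mul_simple_cancel_right]
    have := cs.length_wordProd_le ω
    simp
    lia

/-- A right descent `j ∈ J` of `s_i w` would make `s_i w s_j` at least two shorter than `w`, and
then `w s_j` would be shorter than `w`. -/
theorem simple_mul_mem_minCosetReps {w : W} {i : B} (hw : w ∈ cs.minCosetReps J)
    (hi : cs.IsLeftDescent w i) : cs.simple i * w ∈ cs.minCosetReps J := by
  rw [mem_minCosetReps_iff] at hw ⊢
  intro j hj hd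
  apply hw j hj
  rw [isLeftDescent_iff] at hi
  rw [IsRightDescent] at hd ⊢
  have h1 := cs.length_mul_le (cs.simple i) (cs.simple i * w * cs.simple j)
  rw [length_simple, ← mul_assoc, simple_mul_simple_cancel_left] at h1
  lia

/-- Left multiplication by `i` amounts to right multiplication by an element of `J`. -/
def Absorbs (J : Set B) (i : B) (w : W) : Prop := ∃ j ∈ J, cs.simple i * w = w * cs.simple j

theorem Absorbs.notMem_minCosetReps {w : W} {i : B} (h : cs.Absorbs J i w)
    (hi : ¬ cs.IsLeftDescent w i) : cs.simple i * w ∉ cs.minCosetReps J := by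
  obtain ⟨j, hj, h⟩ := h
  rw [mem_minCosetReps_iff]
  intro hm
  apply hm j hj
  rw [not_isLeftDescent_iff] at hi
  rw [IsRightDescent, hi, h, simple_mul_simple_cancel_right]
  lia

/-- Deodhar's lemma. -/
theorem simple_mul_mem_minCosetReps_or_absorbs {w : W} {i : B} (hw : w ∈ cs.minCosetReps J) :
    cs.simple i * w ∈ cs.minCosetReps J ∨ cs.Absorbs J i w := by
  by_cases hi : cs.IsLeftDescent w i
  · exact Or.inl (cs.simple_mul_mem_minCosetReps hw hi)
  by_contra! hcon
  obtain ⟨h1, h2⟩ := hcon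
  rw [mem_minCosetReps_iff] at h1 hw
  push Not at h1
  obtain ⟨j, hj, hd⟩ := h1
  have hne : w * cs.simple j * w⁻¹ ≠ cs.simple i := by
    intro h
    exact h2 ⟨j, hj, by rw [← h]; simp⟩
  have hrefl := (cs.isReflection_simple j).conj w
  -- A descent `j` of `s_i w` is a left inversion by a conjugate of `w s_j w⁻¹`. As that reflection
  -- is not `s_i`, the inversion pulls back to `w`, making `j` a descent of `w`.
  have h3 : cs.IsLeftInversion (cs.simple i * w)
      (cs.simple i * (w * cs.simple j * w⁻¹) * cs.simple i) := by
    refine ⟨?_, ?_⟩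
    · have := hrefl.conj (cs.simple i)
      rwa [inv_simple] at this
    · have : cs.simple i * (w * cs.simple j * w⁻¹) * cs.simple i * (cs.simple i * w) =
          cs.simple i * w * cs.simple j := by
        simp [mul_assoc]
      rw [this]
      exact hd
  rw [isLeftInversion_simple_mul_conj_iff _ hrefl hne] at h3
  apply hw j hj
  have h4 := h3.2
  rwa [inv_mul_cancel_right] at h4

/-! ### Elements with two left descents, and absorption by a uniquely reduced word. -/

theorem IsLeftInversion.mem_leftInvSeq_or {ω : List B} {x t : W}
    (h : cs.IsLeftInversion (cs.wordProd ω * x) t) :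
    t ∈ cs.leftInvSeq ω ∨
      cs.IsLeftInversion x ((cs.wordProd ω)⁻¹ * t * cs.wordProd ω) := by
  induction ω generalizing t with
  | nil => simpa using h
  | cons i ω ih =>
    by_cases hti : t = cs.simple i
    · left
      rw [hti, leftInvSeq]
      exact List.mem_cons_self
    · have hc : cs.simple i * (cs.simple i * t * cs.simple i) * cs.simple i = t := by
        simp [mul_assoc]
      have ht : cs.IsReflection (cs.simple i * t * cs.simple i) := by
        have := h.1.conj (cs.simple i)
        rwa [inv_simple] at this
      have hne : cs.simple i * t * cs.simple i ≠ cs.simple i := by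
        intro h'
        apply hti
        rw [← hc, h']
        simp
      rw [wordProd_cons, mul_assoc, ← hc, isLeftInversion_simple_mul_conj_iff _ ht hne] at h
      rcases ih h with h | h
      · left
        rw [leftInvSeq]
        refine List.mem_cons_of_mem _ (List.mem_map.2 ⟨_, h, ?_⟩)
        rw [MulAut.conj_apply, inv_simple, hc]
      · right
        rw [wordProd_cons]
        simpa [mul_assoc] using h

/-- The factor in front is the letter that would continue the alternation. If that letter were
itself `t`, a power of exponent at most `n` would be trivial, which is excluded while `n` is below
the label. -/
theorem exists_pow_of_mem_leftInvSeq_alternatingWord {i j : B} {n : ℕ} {t : W}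
    (h : t ∈ cs.leftInvSeq (alternatingWord i j n)) :
    ∃ k < n, cs.simple (if Even n then j else i) * t =
      (cs.simple (if Even n then j else i) * cs.simple (if Even n then i else j)) ^ (k + 1) := by
  induction n generalizing t with
  | zero => simp [alternatingWord] at h
  | succ n ih =>
    rw [alternatingWord_succ', leftInvSeq, List.mem_cons, List.mem_map] at h
    have hif {α : Type _} (x y : α) : (if Even (n + 1) then x else y) = if Even n then y else x := by
      by_cases hn : Even n <;> simp [hn, Nat.even_add_one]
    rw [hif, hif]
    rcases h with rfl | ⟨t', ht', rfl⟩
    · exact ⟨0, by lia, by simp⟩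
    · obtain ⟨k, hk, h⟩ := ih ht'
      refine ⟨k + 1, by lia, ?_⟩
      rw [MulAut.conj_apply, h, inv_simple, pow_succ _ (k + 1), ← mul_assoc, ← mul_assoc]
      congr 1
      rw [← mul_pow_mul]

/-- The alternating prefix grows one letter at a time. The next letter `c` is a left descent of `w`,
and the order of `s_i s_j` keeps it out of the inversion sequence of the prefix `u`. Hence `u⁻¹ c u`
is an inversion of the remainder and shortens it. -/
theorem exists_eq_alternatingWord_mul {w : W} {i j : B}
    (hi : cs.IsLeftDescent w i) (hj : cs.IsLeftDescent w j) {n : ℕ}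
    (hn : M i j = 0 ∨ n ≤ M i j) :
    ∃ x, w = cs.wordProd (alternatingWord i j n) * x ∧ cs.length w = n + cs.length x := by
  induction n with
  | zero => exact ⟨w, by simp [alternatingWord], by simp⟩
  | succ n ih =>
    obtain ⟨x, hx, hl⟩ := ih (by lia)
    set c := if Even n then j else i with hc
    have hd : cs.IsLeftDescent w c := by
      rw [hc]
      split_ifs <;> assumption
    have hinv := (cs.isLeftInversion_simple_iff_isLeftDescent w c).2 hd
    rw [hx] at hinv
    rcases IsLeftInversion.mem_leftInvSeq_or cs hinv with h | h
    · obtain ⟨k, hk, h⟩ := cs.exists_pow_of_mem_leftInvSeq_alternatingWord h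
      rw [← hc, simple_mul_simple_self] at h
      have h1 := cs.label_le_of_simple_mul_simple_pow_eq_one (Nat.succ_pos k) h.symm
      have h2 : M c (if Even n then i else j) = M i j := by
        rw [hc]
        split_ifs
        · exact M.symmetric _ _
        · rfl
      lia
    · set u := cs.wordProd (alternatingWord i j n) with hu
      refine ⟨u⁻¹ * cs.simple c * u * x, ?_, ?_⟩
      · rw [alternatingWord_succ', ← hc, wordProd_cons, ← hu, hx]
        simp [mul_assoc]
      · have h1 := h.2
        have h2 : w = cs.simple c * (u * (u⁻¹ * cs.simple c * u * x)) := by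
          rw [hx]
          simp [mul_assoc]
        have h3 := cs.length_mul_le (cs.simple c) (u * (u⁻¹ * cs.simple c * u * x))
        have h4 := cs.length_mul_le u (u⁻¹ * cs.simple c * u * x)
        have h5 := cs.length_wordProd_le (alternatingWord i j n)
        rw [← h2, length_simple] at h3
        rw [← hu, length_alternatingWord] at h5
        lia

/-- `ω` is the one and only reduced word of its product. -/
def IsUniquelyReduced (ω : List B) : Prop :=
  cs.IsReduced ω ∧ ∀ ω', cs.IsReduced ω' → cs.wordProd ω' = cs.wordProd ω → ω' = ω

theorem IsUniquelyReduced.isLeftDescent_iff {ω : List B} (h : cs.IsUniquelyReduced ω) {i : B} :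
    cs.IsLeftDescent (cs.wordProd ω) i ↔ ω.head? = some i := by
  constructor
  · intro hd
    obtain ⟨ρ, hρ, hp⟩ := cs.exists_isReduced (cs.simple i * cs.wordProd ω)
    have hw : cs.wordProd (i :: ρ) = cs.wordProd ω := by
      rw [wordProd_cons, ← hp, simple_mul_simple_cancel_left]
    rw [CoxeterSystem.isLeftDescent_iff, hp, hρ.eq] at hd
    rw [← h.2 (i :: ρ) (by rw [IsReduced, hw, ← hd]; rfl) hw]
    rfl
  · intro hh
    obtain ⟨ρ, rfl⟩ := List.head?_eq_some_iff.1 hh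
    rw [IsLeftDescent, h.1.eq, wordProd_cons, simple_mul_simple_cancel_left]
    have := cs.length_wordProd_le ρ
    rw [List.length_cons]
    lia

/-- Reading `s_i v` also as `v s_j` shows that `a` is a left descent next to `i`, so a full side of
the braid relation can be split off. Cancelling `s_i` leaves an alternating prefix of `v` itself,
and uniqueness of the reduced word turns this into an equality of words. -/
theorem IsUniquelyReduced.exists_of_absorbs {a i : B} {ω : List B}
    (h : cs.IsUniquelyReduced (a :: ω)) (hia : i ≠ a)
    (habs : cs.Absorbs J i (cs.wordProd (a :: ω))) :
    ∃ y z x p, M i a = p + 1 ∧ M y z = p + 1 ∧ (if Even p then z else y) = i ∧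
      (if Even p then y else z) = a ∧ a :: ω = alternatingWord y z p ++ x ∧
      cs.Absorbs J y (cs.wordProd x) := by
  obtain ⟨j, hj, habs⟩ := habs
  set v := cs.wordProd (a :: ω) with hv
  have hvl : cs.length v = ω.length + 1 := h.1
  have hiv : ¬ cs.IsLeftDescent v i := by
    rw [h.isLeftDescent_iff]
    simpa using hia.symm
  have hwl : cs.length (cs.simple i * v) = ω.length + 2 := by
    rw [(cs.not_isLeftDescent_iff).1 hiv, hvl]
  have hdi : cs.IsLeftDescent (cs.simple i * v) i := by
    rw [IsLeftDescent, simple_mul_simple_cancel_left]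
    lia
  have hda : cs.IsLeftDescent (cs.simple i * v) a := by
    rw [IsLeftDescent, hwl, habs, hv, wordProd_cons, mul_assoc, simple_mul_simple_cancel_left]
    have h1 := cs.length_mul_le (cs.wordProd ω) (cs.simple j)
    have h2 := cs.length_wordProd_le ω
    rw [length_simple] at h1
    lia
  have hm0 : M i a ≠ 0 := by
    intro hm0
    obtain ⟨x, -, hx⟩ := cs.exists_eq_alternatingWord_mul hdi hda
      -- One more than the length of `s_i v`.
      (n := ω.length + 3) (Or.inl hm0)
    lia
  obtain ⟨p, hp⟩ := Nat.exists_eq_succ_of_ne_zero hm0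
  -- An alternating word is named by its last letters; `y` and `z` are chosen by parity so that the
  -- word of length `p + 1` starts with `i`.
  obtain ⟨y, z, hyz, hi, ha, hdy, hdz⟩ : ∃ y z, M y z = p + 1 ∧ (if Even p then z else y) = i ∧
      (if Even p then y else z) = a ∧ cs.IsLeftDescent (cs.simple i * v) y ∧
      cs.IsLeftDescent (cs.simple i * v) z := by
    by_cases he : Even p
    · exact ⟨a, i, by rw [M.symmetric, hp], by simp [he], by simp [he], hda, hdi⟩
    · exact ⟨i, a, hp, by simp [he], by simp [he], hdi, hda⟩
  obtain ⟨X, hX, hXl⟩ := cs.exists_eq_alternatingWord_mul hdy hdz (n := p + 1) (Or.inr hyz.ge)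
  obtain ⟨x, hx, rfl⟩ := cs.exists_isReduced X
  have hvx : v = cs.wordProd (alternatingWord y z p) * cs.wordProd x := by
    rw [alternatingWord_succ', hi, wordProd_cons, mul_assoc] at hX
    exact mul_left_cancel hX
  refine ⟨y, z, x, p, hp, hyz, hi, ha, ?_, j, hj, ?_⟩
  · symm
    apply h.2
    · rw [IsReduced, wordProd_append, ← hvx, hvl, List.length_append, length_alternatingWord,
        ← hx.eq]
      lia
    · rw [wordProd_append, ← hvx]
  -- The other side of the braid relation is the length-`p` prefix followed by `y`. Cancelling that
  -- prefix leaves `y` absorbed by `x` with the same `j`.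
  · have hbraid := cs.wordProd_braidWord_eq y z
    rw [braidWord, braidWord, M.symmetric z y, hyz] at hbraid
    rw [hbraid, habs, alternatingWord_succ, wordProd_concat, hvx, mul_assoc, mul_assoc] at hX
    exact (mul_left_cancel hX).symm

theorem absorbs_alternatingWord_mul {y z : B} {p : ℕ} (hyz : M y z = p + 1) {x : W}
    (h : cs.Absorbs J y x) :
    cs.Absorbs J (if Even p then z else y) (cs.wordProd (alternatingWord y z p) * x) := by
  obtain ⟨j, hj, h⟩ := h
  refine ⟨j, hj, ?_⟩
  have hbraid := cs.wordProd_braidWord_eq y z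
  rw [braidWord, braidWord, M.symmetric z y, hyz, alternatingWord_succ', wordProd_cons,
    alternatingWord_succ, wordProd_concat] at hbraid
  rw [← mul_assoc, hbraid, mul_assoc, h, mul_assoc]

end CoxeterSystem

/-! ### Chain words and their equivalence with chainlike elements. -/

namespace CoxeterSystem

variable {B W : Type*} [Group W] {M : CoxeterMatrix B} (cs : CoxeterSystem M W) {J : Set B}

/-- Words built letter by letter so that the suffixes of `ω` represent exactly the elements
of `W^J` below the product of `ω`. -/
inductive IsChainWord (J : Set B) : List B → Prop
  | nil : IsChainWord J []
  | cons (i : B) (ω : List B) : IsChainWord J ω → ω.head? ≠ some i →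
      ¬ cs.Absorbs J i (cs.wordProd ω) →
      (∀ υ, υ <:+ ω → υ ≠ ω →
        υ.head? = some i ∨ cs.Absorbs J i (cs.wordProd υ) ∨ i :: υ <:+ ω) →
      IsChainWord J (i :: ω)

theorem IsChainWord.of_isSuffix {υ ω : List B} (hω : cs.IsChainWord J ω) (h : υ <:+ ω) :
    cs.IsChainWord J υ := by
  induction hω with
  | nil => rw [List.suffix_nil.1 h]; exact .nil
  | cons i ω h1 h2 h3 h4 ih =>
    rcases List.suffix_cons_iff.1 h with rfl | h
    · exact .cons i ω h1 h2 h3 h4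
    · exact ih h

theorem isUniquelyReduced_nil : cs.IsUniquelyReduced [] := by
  refine ⟨by simp [IsReduced], fun ω' h h' => ?_⟩
  rw [IsReduced, h', wordProd_nil, length_one] at h
  exact List.length_eq_zero_iff.1 h.symm

theorem one_mem_minCosetReps : (1 : W) ∈ cs.minCosetReps J :=
  (1 : ParabolicQuotient cs J).mem

theorem IsUniquelyReduced.isReduced_cons {ω : List B} (h : cs.IsUniquelyReduced ω) {i : B}
    (hi : ω.head? ≠ some i) : cs.IsReduced (i :: ω) := by
  rwa [isReduced_cons_iff cs h.1, h.isLeftDescent_iff]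

/-- The three claims need each other in one induction. An element `u` below `s_i w` has `u` or `s_i
u` below `w`, hence represented by a suffix, and the chain condition handles `s_i` times a suffix.
Uniqueness follows: deleting the first letter of any reduced word stays in `W^J`, so it gives a
suffix of length one less, which is `ω`. -/
theorem IsChainWord.spec {ω : List B} (hω : cs.IsChainWord J ω) :
    cs.IsUniquelyReduced ω ∧ cs.wordProd ω ∈ cs.minCosetReps J ∧
      ∀ u ∈ cs.minCosetReps J, cs.BruhatLE u (cs.wordProd ω) →
        ∃ υ, υ <:+ ω ∧ u = cs.wordProd υ := by
  induction hω with
  | nil =>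
    refine ⟨cs.isUniquelyReduced_nil, by rw [wordProd_nil]; exact cs.one_mem_minCosetReps, ?_⟩
    intro u _ hle
    refine ⟨[], List.suffix_rfl, ?_⟩
    have := hle.length_le
    rw [wordProd_nil, length_one, Nat.le_zero, length_eq_zero_iff] at this
    rw [this, wordProd_nil]
  | cons i ω hω h2 h3 h4 ih =>
    obtain ⟨hu, hm, hideal⟩ := ih
    have hred := hu.isReduced_cons cs h2
    have hdesc : ¬ cs.IsLeftDescent (cs.wordProd ω) i := by rwa [hu.isLeftDescent_iff]
    have hmem : cs.wordProd (i :: ω) ∈ cs.minCosetReps J := by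
      rw [wordProd_cons]
      exact (cs.simple_mul_mem_minCosetReps_or_absorbs hm).resolve_right h3
    have hid : ∀ u ∈ cs.minCosetReps J, cs.BruhatLE u (cs.wordProd (i :: ω)) →
        ∃ υ, υ <:+ i :: ω ∧ u = cs.wordProd υ := by
      intro u hum hle
      have hd : cs.IsLeftDescent (cs.wordProd (i :: ω)) i := by
        rw [wordProd_cons, isLeftDescent_iff_not_isLeftDescent_mul, simple_mul_simple_cancel_left]
        exact hdesc
      have hlow := hle.leftLower cs i
      rw [leftLower, leftLower, if_pos hd, wordProd_cons, simple_mul_simple_cancel_left] at hlow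
      split_ifs at hlow with hdu
      · obtain ⟨υ, hυ, he⟩ := hideal _ (cs.simple_mul_mem_minCosetReps hum hdu) hlow
        have hue : u = cs.simple i * cs.wordProd υ := by
          rw [← he, simple_mul_simple_cancel_left]
        by_cases hυω : υ = ω
        · exact ⟨i :: ω, List.suffix_rfl, by rw [hue, hυω, wordProd_cons]⟩
        rcases h4 υ hυ hυω with h | h | h
        · obtain ⟨υ', rfl⟩ := List.head?_eq_some_iff.1 h
          refine ⟨υ', ((List.suffix_cons _ _).trans hυ).trans (List.suffix_cons _ _), ?_⟩
          rw [hue, wordProd_cons, simple_mul_simple_cancel_left]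
        · exfalso
          rw [isLeftDescent_iff_not_isLeftDescent_mul, he] at hdu
          exact h.notMem_minCosetReps cs hdu (hue ▸ hum)
        · exact ⟨i :: υ, h.trans (List.suffix_cons _ _), by rw [hue, wordProd_cons]⟩
      · obtain ⟨υ, hυ, he⟩ := hideal u hum hlow
        exact ⟨υ, hυ.trans (List.suffix_cons _ _), he⟩
    refine ⟨⟨hred, ?_⟩, hmem, hid⟩
    intro ρ hρ hρω
    match ρ with
    | [] =>
      have h1 := hred.eq
      rw [← hρω] at h1
      simp at h1
    | j :: ρ =>
      have hρ' := IsReduced.tail cs hρ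
      have hdj : cs.IsLeftDescent (cs.wordProd (i :: ω)) j := by
        rw [← hρω, wordProd_cons, isLeftDescent_iff_not_isLeftDescent_mul,
          simple_mul_simple_cancel_left]
        exact (cs.isReduced_cons_iff hρ').1 hρ
      have hlen : ρ.length = ω.length := by
        have h1 := hρ.eq
        rw [hρω, hred.eq] at h1
        simpa using h1.symm
      obtain ⟨υ, hυ, he⟩ := hid _ (cs.simple_mul_mem_minCosetReps hmem hdj)
        (Relation.ReflTransGen.single (cs.bruhatStep_simple_mul_self hdj))
      have hρυ : cs.wordProd ρ = cs.wordProd υ := by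
        rw [← he, ← hρω, wordProd_cons, simple_mul_simple_cancel_left]
      have hυr : cs.IsReduced υ := by
        obtain ⟨p, hp⟩ := hυ
        rw [← hp] at hred
        simpa using hred.drop p.length
      have hυω : υ = ω := by
        have hl : υ.length = ω.length := by
          rw [← hυr.eq, ← hρυ, hρ'.eq, hlen]
        exact List.IsSuffix.eq_of_length
          (List.suffix_of_suffix_length_le hυ (List.suffix_cons i ω) hl.le) hl
      rw [hυω] at hρυ
      rw [hu.2 ρ hρ' hρυ]
      congr 1
      rw [wordProd_cons, wordProd_cons, hρυ] at hρω
      exact cs.simple_injective (mul_right_cancel hρω)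

namespace ParabolicQuotient

theorem lt_iff {cs : CoxeterSystem M W} {u v : ParabolicQuotient cs J} :
    u < v ↔ cs.BruhatLE u.val v.val ∧ u.val ≠ v.val := by
  rw [lt_iff_le_and_ne]
  refine and_congr Iff.rfl (not_congr ⟨fun h => by rw [h], fun h => ?_⟩)
  cases u
  cases v
  simp_all

theorem length_strictMono {cs : CoxeterSystem M W} {u v : ParabolicQuotient cs J} (h : u < v) :
    cs.length u.val < cs.length v.val := by
  rw [lt_iff] at h
  exact h.1.eq_or_length_lt.resolve_left h.2

theorem exists_le_covBy {cs : CoxeterSystem M W} {u v : ParabolicQuotient cs J} (h : u < v) :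
    ∃ c, u ≤ c ∧ c ⋖ v := by
  induction hn : cs.length v.val - cs.length u.val using Nat.strong_induction_on generalizing u with
  | _ n ih =>
    by_cases hc : u ⋖ v
    · exact ⟨u, le_rfl, hc⟩
    · obtain ⟨c, huc, hcv⟩ := (not_covBy_iff h).1 hc
      have h1 := length_strictMono huc
      have h2 := length_strictMono hcv
      obtain ⟨d, hcd, hdv⟩ := ih _ (by lia) hcv rfl
      exact ⟨d, huc.le.trans hcd, hdv⟩

/-- The element of `W^J` represented by a chain word. -/
def ofChainWord {cs : CoxeterSystem M W} {ω : List B} (hω : cs.IsChainWord J ω) :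
    ParabolicQuotient cs J := ⟨cs.wordProd ω, (hω.spec cs).2.1⟩

theorem coversOnly_ofChainWord {cs : CoxeterSystem M W} {i : B} {ω : List B}
    (h : cs.IsChainWord J (i :: ω)) (hω : cs.IsChainWord J ω) :
    CoversOnly (ofChainWord h) (ofChainWord hω) := by
  have hred := (h.spec cs).1.1
  have hredω := (hω.spec cs).1.1
  have hlt : ofChainWord hω < ofChainWord h := by
    rw [lt_iff]
    refine ⟨cs.bruhatLE_of_isSuffix (List.suffix_cons i ω) hred, fun he => ?_⟩
    have h1 := hred.eq
    change cs.wordProd ω = cs.wordProd (i :: ω) at he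
    rw [← he, hredω.eq] at h1
    simp at h1
  have hbelow : ∀ u : ParabolicQuotient cs J, u < ofChainWord h → u ≤ ofChainWord hω := by
    intro u hu
    obtain ⟨hle, hne⟩ := lt_iff.1 hu
    obtain ⟨υ, hυ, he⟩ := (h.spec cs).2.2 u.val u.mem hle
    rcases List.suffix_cons_iff.1 hυ with rfl | hυ
    · exact absurd he hne
    · change cs.BruhatLE u.val (cs.wordProd ω)
      rw [he]
      exact cs.bruhatLE_of_isSuffix hυ hredω
  intro u
  constructor
  · intro hu
    by_contra hne
    exact hu.2 (lt_of_le_of_ne (hbelow u hu.lt) hne) hlt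
  · rintro rfl
    exact ⟨hlt, fun c hc hc' => absurd (hbelow c hc') hc.not_ge⟩

/-- For a left descent `i` of `w`, the element `s_i w` lies in `W^J` below `w`, hence below the only
cover, and by length equals it. For a proper suffix with neither head `i` nor absorption, `s_i`
times it lies strictly below `w` by lifting, so it is again represented by a suffix. -/
theorem CoversOnly.exists_isChainWord {cs : CoxeterSystem M W} {w : ParabolicQuotient cs J}
    {ω : List B} (hω : cs.IsChainWord J ω) (h : CoversOnly w (ofChainWord hω)) :
    ∃ i, cs.IsChainWord J (i :: ω) ∧ cs.wordProd (i :: ω) = w.val := by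
  obtain ⟨hu, hm, hideal⟩ := hω.spec cs
  have hcov := (h _).2 rfl
  have hlen := length_strictMono hcov.lt
  have hw1 : w.val ≠ 1 := by
    intro h1
    rw [h1, length_one] at hlen
    lia
  have hlt_le : ∀ u : ParabolicQuotient cs J, u < w → u ≤ ofChainWord hω := by
    intro u hu
    obtain ⟨c, huc, hc⟩ := exists_le_covBy hu
    rwa [(h c).1 hc] at huc
  obtain ⟨i, hi⟩ := cs.exists_leftDescent_of_ne_one hw1
  have hiw : cs.simple i * w.val = cs.wordProd ω := by
    have hle : (⟨_, cs.simple_mul_mem_minCosetReps w.mem hi⟩ : ParabolicQuotient cs J) < w := by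
      rw [lt_iff]
      refine ⟨Relation.ReflTransGen.single (cs.bruhatStep_simple_mul_self hi), fun he => ?_⟩
      rw [IsLeftDescent] at hi
      exact hi.ne (congrArg cs.length he)
    refine (BruhatLE.eq_or_length_lt (hlt_le _ hle)).resolve_right ?_
    rw [isLeftDescent_iff] at hi
    dsimp only [ofChainWord] at hlen ⊢
    lia
  have hw : cs.wordProd (i :: ω) = w.val := by
    rw [wordProd_cons, ← hiw, simple_mul_simple_cancel_left]
  have hdesc : ¬ cs.IsLeftDescent (cs.wordProd ω) i := by
    rw [← hiw, ← isLeftDescent_iff_not_isLeftDescent_mul]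
    exact hi
  refine ⟨i, .cons i ω hω ?_ ?_ ?_, hw⟩
  · rwa [Ne, ← hu.isLeftDescent_iff]
  · intro habs
    apply habs.notMem_minCosetReps cs hdesc
    rw [← wordProd_cons, hw]
    exact w.mem
  · intro υ hυ hυω
    by_contra! hcon
    obtain ⟨hc1, hc2, hc3⟩ := hcon
    obtain ⟨hυu, hυm, -⟩ := (hω.of_isSuffix cs hυ).spec cs
    have hred := hυu.isReduced_cons cs hc1
    have hυd : ¬ cs.IsLeftDescent (cs.wordProd υ) i := by rwa [hυu.isLeftDescent_iff]
    have hmem := (cs.simple_mul_mem_minCosetReps_or_absorbs hυm (i := i)).resolve_right hc2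
    have hle := (cs.bruhatLE_of_isSuffix hυ hu.1).leftUpper cs i
    rw [leftUpper, leftUpper, if_neg hυd, if_neg hdesc, ← wordProd_cons _ _ ω, hw] at hle
    have hlt : (⟨_, hmem⟩ : ParabolicQuotient cs J) < w := by
      rw [lt_iff]
      refine ⟨hle, fun he => ?_⟩
      have h1 : cs.simple i * cs.wordProd υ = cs.simple i * cs.wordProd ω := by
        rw [← wordProd_cons _ _ ω, hw]
        exact he
      exact hυω (hu.2 υ hυu.1 (mul_left_cancel h1))
    obtain ⟨υ', hυ', he⟩ := hideal _ hmem (hlt_le _ hlt)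
    rw [← wordProd_cons] at he
    apply hc3
    rwa [((hω.of_isSuffix cs hυ').spec cs).1.2 _ hred he]

end ParabolicQuotient

open ParabolicQuotient in
theorem mem_chainlikes_iff {w : W} :
    w ∈ cs.chainlikes J ↔ ∃ ω, ω ≠ [] ∧ cs.IsChainWord J ω ∧ cs.wordProd ω = w := by
  constructor
  · rintro ⟨hw, h⟩
    generalize hw' : (⟨w, hw⟩ : ParabolicQuotient cs J) = w' at h
    have hval : w = w'.val := by rw [← hw']
    rw [hval]
    clear hval hw' hw w
    induction h with
    | base w h =>
      have h0 : (1 : ParabolicQuotient cs J) = ofChainWord (.nil : cs.IsChainWord J []) := rfl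
      rw [h0] at h
      obtain ⟨i, hi, he⟩ := h.exists_isChainWord
      exact ⟨_, List.cons_ne_nil _ _, hi, he⟩
    | step w w' h _ ih =>
      obtain ⟨ω, -, hω, he⟩ := ih
      have h0 : w' = ofChainWord hω := by
        cases w'
        simp only [ofChainWord, he]
      rw [h0] at h
      obtain ⟨i, hi, he⟩ := h.exists_isChainWord
      exact ⟨_, List.cons_ne_nil _ _, hi, he⟩
  · rintro ⟨ω, hne, hω, rfl⟩
    refine ⟨(hω.spec cs).2.1, ?_⟩
    change IsChainlike (ofChainWord hω)
    induction ω with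
    | nil => exact absurd rfl hne
    | cons i ω ih =>
      have hω' := hω.of_isSuffix cs (List.suffix_cons i ω)
      have hc := coversOnly_ofChainWord hω hω'
      rcases eq_or_ne ω [] with rfl | hne'
      · exact .base _ hc
      · exact .step _ _ hc (ih hne' hω')

end CoxeterSystem

/-! ### Combinatorics of the descending, bouncing and zigzagging words. -/

namespace CoxeterMatrix

variable {B : Type*} {M : CoxeterMatrix B} {J : Set B} {s : ℕ → B} {k : ℕ}

theorem natCast_le_label_iff {i j : B} {n : ℕ} :
    (n : ℕ∞) ≤ M.label i j ↔ M i j = 0 ∨ n ≤ M i j := by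
  unfold label
  split_ifs with h <;> simp [h]

theorem natCast_lt_label_iff {i j : B} {n : ℕ} :
    (n : ℕ∞) < M.label i j ↔ M i j = 0 ∨ n < M i j := by
  unfold label
  split_ifs with h <;> simp [h]

theorem label_eq_three_iff {i j : B} : M.label i j = 3 ↔ M i j = 3 := by
  unfold label
  split_ifs with h
  · simp [h]
  · norm_cast

theorem descWord_zero : descWord s 0 = [] := rfl

theorem descWord_succ (n : ℕ) : descWord s (n + 1) = s n :: descWord s n := by
  simp [descWord, List.range_succ]

theorem mem_descWord {n : ℕ} {a : B} : a ∈ descWord s n ↔ ∃ h < n, s h = a := by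
  simp [descWord]

theorem descWord_congr {s' : ℕ → B} {n : ℕ} (h : ∀ i < n, s i = s' i) :
    descWord s n = descWord s' n := by
  unfold descWord
  congr 1
  apply List.map_congr_left
  intro i hi
  exact h i (List.mem_range.1 hi)

theorem exists_of_isSuffix_descWord {n : ℕ} {υ : List B} (h : υ <:+ descWord s n) :
    ∃ m ≤ n, υ = descWord s m := by
  induction n with
  | zero => exact ⟨0, le_rfl, List.suffix_nil.1 h⟩
  | succ n ih =>
    rw [descWord_succ] at h
    rcases List.suffix_cons_iff.1 h with rfl | h
    · exact ⟨n + 1, le_rfl, (descWord_succ n).symm⟩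
    · obtain ⟨m, hm, he⟩ := ih h
      exact ⟨m, by lia, he⟩

theorem descWord_isSuffix {m n : ℕ} (h : m ≤ n) : descWord s m <:+ descWord s n := by
  induction n, h using Nat.le_induction with
  | base => exact List.suffix_rfl
  | succ n _ ih =>
    rw [descWord_succ]
    exact ih.trans (List.suffix_cons _ _)

namespace IsSimpleSeq

theorem mono {n : ℕ} (h : M.IsSimpleSeq J s k) (hn : n ≤ k) : M.IsSimpleSeq J s n where
  distinct i j hi hj := h.distinct i j (hi.trans hn) (hj.trans hn)
  zero_notMem := h.zero_notMem
  mem i hi hi' := h.mem i hi (hi'.trans hn)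
  edge_iff i j hi hj := h.edge_iff i j (hi.trans hn) (hj.trans hn)

theorem commute (h : M.IsSimpleSeq J s k) {i j : ℕ} (hi : i ≤ k) (hj : j ≤ k)
    (hij : i + 1 < j ∨ j + 1 < i) : M (s i) (s j) = 2 := by
  have h1 : ¬ (3 ≤ M.label (s i) (s j)) := by
    rw [h.edge_iff i j hi hj]
    lia
  have h2 : M (s i) (s j) ≠ 1 := by
    apply M.off_diagonal
    intro he
    have := h.distinct i j hi hj he
    lia
  rw [← Nat.cast_ofNat (n := 3), natCast_le_label_iff] at h1
  lia

theorem adjacent (h : M.IsSimpleSeq J s k) {i : ℕ} (hi : i + 1 ≤ k) :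
    M (s i) (s (i + 1)) = 0 ∨ 3 ≤ M (s i) (s (i + 1)) := by
  rw [← natCast_le_label_iff, Nat.cast_ofNat, h.edge_iff i (i + 1) (by lia) hi]
  exact Or.inl rfl

theorem congr {s' : ℕ → B} (h : M.IsSimpleSeq J s k) (hs : ∀ i ≤ k, s i = s' i) :
    M.IsSimpleSeq J s' k where
  distinct i j hi hj := by rw [← hs i hi, ← hs j hj]; exact h.distinct i j hi hj
  zero_notMem := by rw [← hs 0 (Nat.zero_le _)]; exact h.zero_notMem
  mem i hi hi' := by rw [← hs i hi']; exact h.mem i hi hi'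
  edge_iff i j hi hj := by rw [← hs i hi, ← hs j hj]; exact h.edge_iff i j hi hj

theorem succ (h : M.IsSimpleSeq J s k) (hJ : s (k + 1) ∈ J) (hne : ∀ i ≤ k, s i ≠ s (k + 1))
    (hcomm : ∀ i < k, M (s i) (s (k + 1)) = 2) (hedge : M (s k) (s (k + 1)) ≠ 2) :
    M.IsSimpleSeq J s (k + 1) := by
  have hlabel : ∀ i ≤ k, (3 ≤ M.label (s i) (s (k + 1)) ↔ i = k) := by
    intro i hi
    rw [← Nat.cast_ofNat (n := 3), natCast_le_label_iff]
    rcases Nat.lt_or_eq_of_le hi with hlt | rfl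
    · rw [hcomm i hlt]
      lia
    · have := M.off_diagonal _ _ (hne i le_rfl)
      lia
  have hsymm : ∀ i j, M.label i j = M.label j i := by
    intro i j
    rw [label, label, M.symmetric]
  refine ⟨?_, h.zero_notMem, ?_, ?_⟩
  · intro i j hi hj hij
    rcases Nat.lt_or_eq_of_le hi with hi | rfl <;> rcases Nat.lt_or_eq_of_le hj with hj | rfl
    · exact h.distinct i j (by lia) (by lia) hij
    · exact absurd hij (hne i (by lia))
    · exact absurd hij.symm (hne j (by lia))
    · rfl
  · intro i hi hi'
    rcases Nat.lt_or_eq_of_le hi' with hi' | rfl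
    · exact h.mem i hi (by lia)
    · exact hJ
  · intro i j hi hj
    rcases Nat.lt_or_eq_of_le hi with hi | rfl <;> rcases Nat.lt_or_eq_of_le hj with hj | rfl
    · exact h.edge_iff i j (by lia) (by lia)
    · rw [hlabel i (by lia)]
      lia
    · rw [hsymm, hlabel j (by lia)]
      lia
    · rw [← Nat.cast_ofNat (n := 3), natCast_le_label_iff, M.diagonal]
      lia

end IsSimpleSeq

/-- The word `s l, s (l + 1), …, s (k - 1), s k, s (k - 1), …, s 0`. -/
def bounceWord (s : ℕ → B) (k l : ℕ) : List B :=
  (List.range' l (k - l)).map s ++ descWord s (k + 1)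

theorem bounceWord_self : bounceWord s k k = descWord s (k + 1) := by
  simp [bounceWord]

theorem bounceWord_eq_cons {l : ℕ} (h : l < k) :
    bounceWord s k l = s l :: bounceWord s k (l + 1) := by
  obtain ⟨d, rfl⟩ := Nat.exists_eq_add_of_lt h
  have h1 : l + d + 1 - l = d + 1 := by lia
  have h2 : l + d + 1 - (l + 1) = d := by lia
  rw [bounceWord, bounceWord, h1, h2, List.range'_succ]
  rfl

theorem mem_bounceWord {l : ℕ} {a : B} (h : a ∈ bounceWord s k l) : ∃ i ≤ k, s i = a := by
  rcases List.mem_append.1 h with h | h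
  · obtain ⟨i, hi, rfl⟩ := List.mem_map.1 h
    rw [List.mem_range'_1] at hi
    exact ⟨i, by lia, rfl⟩
  · obtain ⟨i, hi, rfl⟩ := mem_descWord.1 h
    exact ⟨i, by lia, rfl⟩

theorem exists_of_isSuffix_bounceWord {l : ℕ} (hl : l ≤ k) {υ : List B}
    (h : υ <:+ bounceWord s k l) :
    (∃ i, l ≤ i ∧ i ≤ k ∧ υ = bounceWord s k i) ∨ ∃ i ≤ k, υ = descWord s i := by
  induction hl using Nat.decreasingInduction with
  | self =>
    rw [bounceWord_self] at h
    obtain ⟨i, hi, rfl⟩ := exists_of_isSuffix_descWord h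
    rcases Nat.lt_or_eq_of_le hi with hi | rfl
    · exact Or.inr ⟨i, by lia, rfl⟩
    · exact Or.inl ⟨k, le_rfl, le_rfl, bounceWord_self.symm⟩
  | of_succ l hl ih =>
    rw [bounceWord_eq_cons hl] at h
    rcases List.suffix_cons_iff.1 h with rfl | h
    · exact Or.inl ⟨l, le_rfl, hl.le, (bounceWord_eq_cons hl).symm⟩
    · rcases ih h with ⟨i, hi, hi', he⟩ | h
      · exact Or.inl ⟨i, by lia, hi', he⟩
      · exact Or.inr h

theorem descWord_isSuffix_bounceWord (l : ℕ) : descWord s (k + 1) <:+ bounceWord s k l :=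
  List.suffix_append _ _

open CoxeterSystem in
/-- The word of length `m` that alternates between `s (k + 1)` and `s k` and ends with `s k`,
followed by `s (k - 1), …, s 0`. -/
def zigzagWord (s : ℕ → B) (k m : ℕ) : List B :=
  alternatingWord (s (k + 1)) (s k) m ++ descWord s k

theorem zigzagWord_succ (m : ℕ) :
    zigzagWord s k (m + 1) = (if Even m then s k else s (k + 1)) :: zigzagWord s k m := by
  rw [zigzagWord, CoxeterSystem.alternatingWord_succ']
  rfl

theorem zigzagWord_zero : zigzagWord s k 0 = descWord s k := rfl

theorem zigzagWord_one : zigzagWord s k 1 = descWord s (k + 1) := by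
  rw [zigzagWord_succ, zigzagWord_zero, descWord_succ, if_pos Even.zero]

theorem zigzagWord_two : zigzagWord s k 2 = descWord s (k + 2) := by
  rw [zigzagWord_succ, zigzagWord_one, descWord_succ (k + 1), if_neg (by decide)]

theorem zigzagWord_three : zigzagWord s k 3 = bounceWord s (k + 1) k := by
  rw [zigzagWord_succ, zigzagWord_two, bounceWord_eq_cons k.lt_succ_self, bounceWord_self,
    if_pos (by decide)]

theorem mem_zigzagWord {m : ℕ} {a : B} (h : a ∈ zigzagWord s k m) : ∃ i ≤ k + 1, s i = a := by
  induction m with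
  | zero =>
    obtain ⟨i, hi, rfl⟩ := mem_descWord.1 h
    exact ⟨i, by lia, rfl⟩
  | succ m ih =>
    rw [zigzagWord_succ] at h
    rcases List.mem_cons.1 h with rfl | h
    · split_ifs
      · exact ⟨k, by lia, rfl⟩
      · exact ⟨k + 1, le_rfl, rfl⟩
    · exact ih h

theorem zigzagWord_isSuffix {m n : ℕ} (h : m ≤ n) : zigzagWord s k m <:+ zigzagWord s k n := by
  induction n, h using Nat.le_induction with
  | base => exact List.suffix_rfl
  | succ n _ ih =>
    rw [zigzagWord_succ]
    exact ih.trans (List.suffix_cons _ _)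

theorem exists_of_isSuffix_zigzagWord {m : ℕ} {υ : List B} (h : υ <:+ zigzagWord s k m) :
    (∃ i ≤ m, υ = zigzagWord s k i) ∨ ∃ i < k, υ = descWord s i := by
  induction m with
  | zero =>
    obtain ⟨i, hi, rfl⟩ := exists_of_isSuffix_descWord h
    rcases Nat.lt_or_eq_of_le hi with hi | rfl
    · exact Or.inr ⟨i, hi, rfl⟩
    · exact Or.inl ⟨0, le_rfl, rfl⟩
  | succ m ih =>
    rw [zigzagWord_succ] at h
    rcases List.suffix_cons_iff.1 h with rfl | h
    · exact Or.inl ⟨m + 1, le_rfl, (zigzagWord_succ m).symm⟩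
    · rcases ih h with ⟨i, hi, he⟩ | h
      · exact Or.inl ⟨i, by lia, he⟩
      · exact Or.inr h

/-- A convenient regrouping of the three forms. -/
theorem isFormWord_iff {ω : List B} : M.IsFormWord J ω ↔
    (∃ k s, M.IsSimpleSeq J s k ∧ ω = descWord s (k + 1)) ∨
    (∃ k s l, M.IsSimpleSeq J s (k + 1) ∧ l < k ∧
      (M (s (k + 1)) (s k) = 0 ∨ 4 ≤ M (s (k + 1)) (s k)) ∧
      (∀ i, l ≤ i → i < k → M (s i) (s (i + 1)) = 3) ∧ ω = bounceWord s (k + 1) l) ∨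
    (∃ k s m, M.IsSimpleSeq J s (k + 1) ∧ 3 ≤ m ∧
      (M (s (k + 1)) (s k) = 0 ∨ m < M (s (k + 1)) (s k)) ∧ ω = zigzagWord s k m) := by
  constructor
  · rintro ⟨k, s, hs, h | ⟨l, hl, h4, h3, rfl⟩ | ⟨m, hk, hm, hlt, rfl⟩⟩
    · exact Or.inl ⟨k, s, hs, h⟩
    · obtain ⟨k, rfl⟩ := Nat.exists_eq_add_of_lt (lt_of_le_of_lt (Nat.zero_le _) hl)
      rw [zero_add] at *
      rw [← Nat.cast_ofNat (n := 4), natCast_le_label_iff] at h4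
      right
      -- Form (II) with a single step back is the zigzag of length 3, so it is grouped with form
      -- (III).
      rcases Nat.lt_or_eq_of_le (Nat.le_of_lt_succ hl) with hl | rfl
      · exact Or.inl ⟨k, s, l, hs, hl, h4,
          fun i hi hi' => label_eq_three_iff.1 (h3 i hi (by lia)), rfl⟩
      · exact Or.inr ⟨l, s, 3, hs, le_rfl, h4, zigzagWord_three.symm⟩
    · obtain ⟨k, rfl⟩ := Nat.exists_eq_add_of_le' hk
      exact Or.inr (Or.inr ⟨k, s, m, hs, by lia, natCast_lt_label_iff.1 hlt, rfl⟩)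
  · rintro (⟨k, s, hs, h⟩ | ⟨k, s, l, hs, hl, h4, h3, rfl⟩ | ⟨k, s, m, hs, hm, hlt, rfl⟩)
    · exact ⟨k, s, hs, Or.inl h⟩
    · refine ⟨k + 1, s, hs, Or.inr (Or.inl ⟨l, by lia, ?_, ?_, rfl⟩)⟩
      · rw [← Nat.cast_ofNat (n := 4), natCast_le_label_iff]
        exact h4
      · exact fun i hi hi' => label_eq_three_iff.2 (h3 i hi (by lia))
    · refine ⟨k + 1, s, hs, Or.inr ?_⟩
      rcases Nat.lt_or_eq_of_le hm with hm | rfl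
      · exact Or.inr ⟨m, by lia, hm, natCast_lt_label_iff.2 hlt, rfl⟩
      · refine Or.inl ⟨k, by lia, ?_, fun i hi hi' => by lia, zigzagWord_three⟩
        rw [← Nat.cast_ofNat (n := 4), natCast_le_label_iff]
        exact hlt

end CoxeterMatrix

/-! ### The three forms are chain words. -/

namespace CoxeterSystem

open CoxeterMatrix

variable {B W : Type*} [Group W] {M : CoxeterMatrix B} (cs : CoxeterSystem M W) {J : Set B}

theorem absorbs_nil_iff {i : B} : cs.Absorbs J i (cs.wordProd []) ↔ i ∈ J := by
  constructor
  · rintro ⟨j, hj, h⟩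
    rw [wordProd_nil, mul_one, one_mul] at h
    rwa [cs.simple_injective h]
  · intro h
    exact ⟨i, h, by simp⟩

theorem absorbs_cons_iff_of_commute {i a : B} {ω : List B} (h : M i a = 2) :
    cs.Absorbs J i (cs.wordProd (a :: ω)) ↔ cs.Absorbs J i (cs.wordProd ω) := by
  have hc := cs.wordProd_braidWord_eq i a
  rw [braidWord, braidWord, M.symmetric a i, h] at hc
  simp only [alternatingWord, List.concat_eq_append, List.nil_append, List.cons_append,
    wordProd_cons, wordProd_nil, mul_one] at hc
  unfold Absorbs
  refine exists_congr fun j => and_congr_right fun _ => ?_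
  rw [wordProd_cons, ← mul_assoc, hc, mul_assoc, mul_assoc, mul_left_cancel_iff]

theorem absorbs_append_iff_of_commute {i : B} {ω ω' : List B} (h : ∀ a ∈ ω, M i a = 2) :
    cs.Absorbs J i (cs.wordProd (ω ++ ω')) ↔ cs.Absorbs J i (cs.wordProd ω') := by
  induction ω with
  | nil => rfl
  | cons a ω ih =>
    rw [List.cons_append, cs.absorbs_cons_iff_of_commute (h a List.mem_cons_self),
      ih fun b hb => h b (List.mem_cons_of_mem _ hb)]

theorem absorbs_cons_cons_of_label_eq_three {i a : B} {ω : List B} (h : M a i = 3)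
    (ha : cs.Absorbs J a (cs.wordProd ω)) : cs.Absorbs J i (cs.wordProd (a :: i :: ω)) := by
  have := cs.absorbs_alternatingWord_mul (y := a) (z := i) (p := 2) h ha
  simpa [alternatingWord, wordProd_cons, mul_assoc] using this

theorem IsUniquelyReduced.exists_cons_of_absorbs {a i : B} {ω : List B}
    (h : cs.IsUniquelyReduced (a :: ω)) (hia : i ≠ a) (h2 : M i a ≠ 2)
    (habs : cs.Absorbs J i (cs.wordProd (a :: ω))) : ∃ ω', ω = i :: ω' := by
  obtain ⟨y, z, x, p, hp, -, hi, ha, hω, -⟩ := h.exists_of_absorbs cs hia habs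
  have h1 := M.off_diagonal i a hia
  obtain ⟨q, rfl⟩ := Nat.exists_eq_add_of_le' (show 2 ≤ p by lia)
  rw [alternatingWord_succ', alternatingWord_succ'] at hω
  have hq : (if Even q then z else y) = i := by
    rw [← hi]
    simp [Nat.even_add]
  rw [hq] at hω
  exact ⟨_, (List.cons.inj hω).2⟩

theorem IsUniquelyReduced.exists_cons_cons_of_absorbs {a i : B} {ω : List B}
    (h : cs.IsUniquelyReduced (a :: i :: ω)) (hia : i ≠ a) (h2 : M i a ≠ 2) (h3 : M i a ≠ 3)
    (habs : cs.Absorbs J i (cs.wordProd (a :: i :: ω))) : ∃ ω', ω = a :: ω' := by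
  obtain ⟨y, z, x, p, hp, -, hi, ha, hω, -⟩ := h.exists_of_absorbs cs hia habs
  have h1 := M.off_diagonal i a hia
  obtain ⟨q, rfl⟩ := Nat.exists_eq_add_of_le' (show 3 ≤ p by lia)
  rw [alternatingWord_succ', alternatingWord_succ', alternatingWord_succ'] at hω
  have hq : (if Even q then z else y) = a := by
    rw [← ha]
    by_cases hq : Even q <;> simp [hq, Nat.even_add, show ¬ Even 3 by decide]
  rw [hq] at hω
  exact ⟨_, (List.cons.inj (List.cons.inj hω).2).2⟩

variable {s : ℕ → B} {k : ℕ}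

/-- All letters of the word have index at most `j - 2`, so `s j` commutes through to the right end,
where it lies in `J`. -/
theorem absorbs_descWord_of_lt (hs : M.IsSimpleSeq J s k) {j n : ℕ} (hn : n < j) (hj : j ≤ k) :
    cs.Absorbs J (s j) (cs.wordProd (descWord s n)) := by
  rw [← List.append_nil (descWord s n), absorbs_append_iff_of_commute, absorbs_nil_iff]
  · exact hs.mem j (by lia) hj
  · intro a ha
    obtain ⟨h, hh, rfl⟩ := mem_descWord.1 ha
    exact hs.commute hj (by lia) (by lia)

theorem absorbs_descWord_iff_add_two (hs : M.IsSimpleSeq J s k) {j n : ℕ} (hn : j + 2 ≤ n)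
    (hk : n ≤ k + 1) : cs.Absorbs J (s j) (cs.wordProd (descWord s n)) ↔
      cs.Absorbs J (s j) (cs.wordProd (descWord s (j + 2))) := by
  induction n, hn using Nat.le_induction with
  | base => rfl
  | succ n hn ih =>
    rw [descWord_succ, absorbs_cons_iff_of_commute, ih (by lia)]
    exact hs.commute (by lia) (by lia) (by lia)

theorem absorbs_descWord_of_label_eq_three (hs : M.IsSimpleSeq J s k) {j n : ℕ} (hn : j + 2 ≤ n)
    (hk : n ≤ k + 1) (h3 : M (s j) (s (j + 1)) = 3) :
    cs.Absorbs J (s j) (cs.wordProd (descWord s n)) := by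
  rw [cs.absorbs_descWord_iff_add_two hs hn hk, descWord_succ, descWord_succ]
  apply cs.absorbs_cons_cons_of_label_eq_three (by rw [M.symmetric, h3])
  exact cs.absorbs_descWord_of_lt hs (by lia) (by lia)

theorem absorbs_bounceWord_of_lt (hs : M.IsSimpleSeq J s k) {j l : ℕ} (hj : j + 1 < l)
    (hl : l ≤ k) (h3 : M (s j) (s (j + 1)) = 3) :
    cs.Absorbs J (s j) (cs.wordProd (bounceWord s k l)) := by
  rw [bounceWord, absorbs_append_iff_of_commute]
  · exact cs.absorbs_descWord_of_label_eq_three hs (by lia) le_rfl h3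
  · intro a ha
    obtain ⟨i, hi, rfl⟩ := List.mem_map.1 ha
    rw [List.mem_range'_1] at hi
    exact hs.commute (by lia) (by lia) (by lia)

/-- Letters below index `i` commute with `s (i + 1)`. The bounce word then starts `s i, s (i + 1)`,
and the label-3 braid passes the question to `s i` and the part after these two letters, which
absorbs it. -/
theorem absorbs_bounceWord_of_le (hs : M.IsSimpleSeq J s k) {i l : ℕ} (hl : l ≤ i)
    (hi : i + 1 < k) (h3 : M (s i) (s (i + 1)) = 3) :
    cs.Absorbs J (s (i + 1)) (cs.wordProd (bounceWord s k l)) := by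
  induction hl using Nat.decreasingInduction with
  | self =>
    rw [bounceWord_eq_cons (by lia), bounceWord_eq_cons hi]
    exact cs.absorbs_cons_cons_of_label_eq_three h3
      (cs.absorbs_bounceWord_of_lt hs (by lia) (by lia) h3)
  | of_succ l hl ih =>
    rw [bounceWord_eq_cons (by lia), absorbs_cons_iff_of_commute _
      (hs.commute (by lia) (by lia) (by lia))]
    exact ih

theorem absorbs_zigzagWord (hs : M.IsSimpleSeq J s (k + 1)) {m : ℕ}
    (hm : M (s (k + 1)) (s k) = m + 1) :
    cs.Absorbs J (if Even m then s k else s (k + 1)) (cs.wordProd (zigzagWord s k m)) := by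
  rw [zigzagWord, wordProd_append]
  exact cs.absorbs_alternatingWord_mul hm (cs.absorbs_descWord_of_lt hs (by lia) le_rfl)

/-- Absorption would need an alternating prefix longer than `m`. It would reach into `s (k - 1), …,
s 0`, whose letters differ from both alternating ones, or past the end of the word. -/
theorem not_absorbs_zigzagWord (hs : M.IsSimpleSeq J s (k + 1)) {m : ℕ} (hm : 1 ≤ m)
    (hlt : M (s (k + 1)) (s k) = 0 ∨ m + 1 < M (s (k + 1)) (s k))
    (hu : cs.IsUniquelyReduced (zigzagWord s k m)) :
    ¬ cs.Absorbs J (if Even m then s k else s (k + 1)) (cs.wordProd (zigzagWord s k m)) := by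
  intro habs
  obtain ⟨m, rfl⟩ := Nat.exists_eq_add_of_le' hm
  have hne : s k ≠ s (k + 1) := by
    intro h
    have := hs.distinct _ _ (by lia) (by lia) h
    lia
  have hword := zigzagWord_succ (s := s) (k := k) m
  rw [hword] at hu habs
  have hset : ((if Even (m + 1) then s k else s (k + 1)) = s k ∧
      (if Even m then s k else s (k + 1)) = s (k + 1)) ∨
      ((if Even (m + 1) then s k else s (k + 1)) = s (k + 1) ∧
      (if Even m then s k else s (k + 1)) = s k) := by
    by_cases he : Even m <;> simp [he, Nat.even_add_one]
  obtain ⟨y, z, x, p, hp, hyz, hi, ha, hω, -⟩ := hu.exists_of_absorbs cs (by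
    rcases hset with h | h <;> rw [h.1, h.2]
    · exact hne
    · exact hne.symm) habs
  have hpM : M (s (k + 1)) (s k) = p + 1 := by
    rcases hset with h | h <;> rw [h.1, h.2] at hp
    · rw [M.symmetric, hp]
    · exact hp
  have hmp : m + 1 < p := by lia
  have hyz' : ∀ b, b = y ∨ b = z → b = s k ∨ b = s (k + 1) := by
    rcases hset with h | h <;> rw [h.1] at hi <;> rw [h.2] at ha <;>
      by_cases he : Even p <;> simp only [he, if_true, if_false] at hi ha <;> subst hi <;>
      subst ha <;> tauto
  rw [← hword, zigzagWord] at hω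
  have hget : ∀ b ∈ alternatingWord y z p, b = y ∨ b = z := by
    intro b hb
    obtain ⟨n, hn, rfl⟩ := List.getElem_of_mem hb
    rw [length_alternatingWord] at hn
    rw [getElem_alternatingWord _ _ _ _ hn]
    split_ifs <;> simp
  rcases List.append_eq_append_iff.1 hω with ⟨c, h1, h2⟩ | ⟨c, h1, h2⟩
  · have hc : c ≠ [] := by
      rintro rfl
      have := congrArg List.length h1
      simp at this
      lia
    obtain ⟨b, c', rfl⟩ := List.exists_cons_of_ne_nil hc
    have hb1 : b ∈ alternatingWord y z p := by
      rw [h1]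
      simp
    have hb2 : b ∈ descWord s k := by
      rw [h2]
      simp
    obtain ⟨h, hh, rfl⟩ := mem_descWord.1 hb2
    rcases hyz' _ (hget _ hb1) with h' | h'
    · have := hs.distinct _ _ (by lia) (by lia) h'
      lia
    · have := hs.distinct _ _ (by lia) (by lia) h'
      lia
  · have := congrArg List.length h1
    simp at this
    lia

theorem IsChainWord.zigzagWord_add_one (hs : M.IsSimpleSeq J s (k + 1)) {m : ℕ} (hm : 1 ≤ m)
    (hlt : M (s (k + 1)) (s k) = 0 ∨ m + 1 < M (s (k + 1)) (s k))
    (h : cs.IsChainWord J (zigzagWord s k m)) : cs.IsChainWord J (zigzagWord s k (m + 1)) := by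
  have hne : s k ≠ s (k + 1) := by
    intro h
    have := hs.distinct _ _ (by lia) (by lia) h
    lia
  rw [zigzagWord_succ]
  refine .cons _ _ h ?_ (cs.not_absorbs_zigzagWord hs hm hlt (h.spec cs).1) ?_
  · obtain ⟨m, rfl⟩ := Nat.exists_eq_add_of_le' hm
    rw [zigzagWord_succ, List.head?_cons, Ne, Option.some_inj]
    by_cases he : Even m
    · simpa [he, Nat.even_add_one] using hne
    · simpa [he, Nat.even_add_one] using hne.symm
  · intro υ hυ hυne
    rcases exists_of_isSuffix_zigzagWord hυ with ⟨n, hn, rfl⟩ | ⟨n, hn, rfl⟩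
    · have hn : n < m := lt_of_le_of_ne hn (fun h => hυne (by rw [h]))
      by_cases hpar : Even n ↔ Even m
      · right; right
        simp only [← hpar]
        rw [← zigzagWord_succ]
        exact zigzagWord_isSuffix hn
      -- At `n = 0` the alternating part is empty and has no head to compare with; the letter to
      -- prepend is then `s (k + 1)`, which is absorbed.
      · rcases Nat.eq_zero_or_pos n with rfl | hpos
        · right; left
          have hm' : ¬ Even m := fun h => hpar (by simp [h])
          rw [if_neg hm', zigzagWord_zero]
          exact cs.absorbs_descWord_of_lt hs (by lia) le_rfl
        · left
          obtain ⟨n, rfl⟩ := Nat.exists_eq_add_of_le' hpos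
          have hnm : Even n ↔ Even m := by
            rw [Nat.even_add_one] at hpar
            tauto
          simp only [← hnm]
          rw [zigzagWord_succ, List.head?_cons]
    · right; left
      split_ifs
      · exact cs.absorbs_descWord_of_lt hs hn (by lia)
      · exact cs.absorbs_descWord_of_lt hs (by lia) le_rfl

/-- Each letter after the first is the second letter of a zigzag on the preceding generators, so the
zigzag extension step covers this case as well. -/
theorem isChainWord_descWord (hs : M.IsSimpleSeq J s k) {n : ℕ} (hn : n ≤ k + 1) :
    cs.IsChainWord J (descWord s n) := by
  induction n with
  | zero => exact .nil
  | succ n ih =>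
    rcases Nat.eq_zero_or_pos n with rfl | hpos
    · rw [descWord_succ, descWord_zero]
      refine .cons _ _ .nil (by simp) ?_ ?_
      · rw [absorbs_nil_iff]
        exact hs.zero_notMem
      · intro υ hυ hne
        exact absurd (List.suffix_nil.1 hυ) hne
    · obtain ⟨n, rfl⟩ := Nat.exists_eq_add_of_le' hpos
      rw [← zigzagWord_two]
      refine IsChainWord.zigzagWord_add_one cs (hs.mono (by lia)) le_rfl ?_ ?_
      · rw [M.symmetric]
        exact hs.adjacent (by lia)
      · rw [zigzagWord_one]
        exact ih (by lia)

theorem isChainWord_zigzagWord (hs : M.IsSimpleSeq J s (k + 1)) {m : ℕ} (hm : 1 ≤ m)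
    (hlt : M (s (k + 1)) (s k) = 0 ∨ m < M (s (k + 1)) (s k)) :
    cs.IsChainWord J (zigzagWord s k m) := by
  induction m, hm using Nat.le_induction with
  | base =>
    rw [zigzagWord_one]
    exact cs.isChainWord_descWord hs (by lia)
  | succ m hm ih => exact (ih (by lia)).zigzagWord_add_one cs hs hm hlt

/-- Absorbing `s l` would require `s l` right after the leading `s (l + 1)`, but another letter
stands there. In the longer proper suffixes `s l` is absorbed on the way up, where label 3 makes `s
(l + 1), s l` a braid prefix. -/
theorem isChainWord_bounceWord (hs : M.IsSimpleSeq J s (k + 1)) {l : ℕ} (hl : l ≤ k)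
    (h4 : M (s (k + 1)) (s k) = 0 ∨ 4 ≤ M (s (k + 1)) (s k))
    (h3 : ∀ i, l ≤ i → i < k → M (s i) (s (i + 1)) = 3) :
    cs.IsChainWord J (bounceWord s (k + 1) l) := by
  induction hl using Nat.decreasingInduction with
  | self =>
    rw [← zigzagWord_three]
    exact cs.isChainWord_zigzagWord hs (by lia) h4
  | of_succ l hl ih =>
    have h := ih fun i hi hi' => h3 i (by lia) hi'
    have hne : ∀ i, i ≤ k + 1 → i ≠ l → s i ≠ s l := fun i hi hil he =>
      hil (hs.distinct _ _ hi (by lia) he)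
    have hll := h3 l le_rfl hl
    rw [bounceWord_eq_cons (by lia)]
    refine .cons _ _ h ?_ ?_ ?_
    · rw [bounceWord_eq_cons (by lia), List.head?_cons, Ne, Option.some_inj]
      exact hne _ (by lia) (by lia)
    · intro habs
      have hu := (h.spec cs).1
      rw [bounceWord_eq_cons (by lia)] at hu habs
      obtain ⟨ω', hω'⟩ := hu.exists_cons_of_absorbs cs (hne _ (by lia) (by lia)).symm
        (by lia) habs
      rcases Nat.lt_or_eq_of_le (show l + 2 ≤ k + 1 by lia) with hlt | heq
      · rw [bounceWord_eq_cons hlt] at hω'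
        exact hne _ (by lia) (by lia) (List.cons.inj hω').1
      · have hk : bounceWord s (k + 1) (l + 1 + 1) = s (k + 1) :: descWord s (k + 1) := by
          rw [← heq, bounceWord_self, descWord_succ]
        rw [hk] at hω'
        exact hne _ (by lia) (by lia) (List.cons.inj hω').1
    · intro υ hυ hυne
      rcases exists_of_isSuffix_bounceWord (by lia) hυ with ⟨i, hi, hi', rfl⟩ | ⟨i, hi, rfl⟩
      · right; left
        have : i ≠ l + 1 := fun h => hυne (by rw [h])
        exact cs.absorbs_bounceWord_of_lt hs (by lia) hi' hll
      · rcases lt_trichotomy i l with hil | rfl | hil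
        · exact Or.inr (Or.inl (cs.absorbs_descWord_of_lt hs hil (by lia)))
        · right; right
          rw [← descWord_succ]
          exact (descWord_isSuffix (by lia)).trans (descWord_isSuffix_bounceWord _)
        · rcases Nat.lt_or_eq_of_le hil with hil | rfl
          · exact Or.inr (Or.inl (cs.absorbs_descWord_of_label_eq_three hs hil (by lia) hll))
          · left
            rw [Nat.succ_eq_add_one, descWord_succ, List.head?_cons]

theorem isChainWord_of_isFormWord {ω : List B} (h : M.IsFormWord J ω) :
    ω ≠ [] ∧ cs.IsChainWord J ω := by
  rcases isFormWord_iff.1 h with ⟨k, s, hs, rfl⟩ | ⟨k, s, l, hs, hl, h4, h3, rfl⟩ |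
    ⟨k, s, m, hs, hm, hlt, rfl⟩
  · exact ⟨by rw [descWord_succ]; exact List.cons_ne_nil _ _, cs.isChainWord_descWord hs le_rfl⟩
  · exact ⟨by rw [bounceWord_eq_cons (by lia)]; exact List.cons_ne_nil _ _,
      cs.isChainWord_bounceWord hs hl.le h4 h3⟩
  · refine ⟨?_, cs.isChainWord_zigzagWord hs (by lia) hlt⟩
    obtain ⟨m, rfl⟩ := Nat.exists_eq_add_of_le' (show 1 ≤ m by lia)
    rw [zigzagWord_succ]
    exact List.cons_ne_nil _ _

end CoxeterSystem

/-! ### Every nonempty chain word has one of the three forms. -/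

namespace CoxeterSystem

open CoxeterMatrix

variable {B W : Type*} [Group W] {M : CoxeterMatrix B} (cs : CoxeterSystem M W) {J : Set B}
  {s : ℕ → B} {k : ℕ}

theorem _root_.List.head_eq_of_cons_isSuffix {α : Type*} {a b : α} {l l' : List α}
    (ha : a :: l <:+ l') (hb : b :: l <:+ l') : a = b :=
  (List.cons.inj ((List.suffix_of_suffix_length_le ha hb (by simp)).eq_of_length (by simp))).1

/-- A larger label would need the prefix `s (j + 1), s j, s (j + 1)`, but `s (j + 1)` does not recur
further down. -/
theorem label_eq_three_of_absorbs_descWord (hs : M.IsSimpleSeq J s k) {j n : ℕ} (hn : j + 2 ≤ n)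
    (hk : n ≤ k + 1) (h : cs.Absorbs J (s j) (cs.wordProd (descWord s n))) :
    M (s j) (s (j + 1)) = 3 := by
  rw [cs.absorbs_descWord_iff_add_two hs hn hk, descWord_succ, descWord_succ] at h
  have hu := ((cs.isChainWord_descWord hs (n := j + 2) (by lia)).spec cs).1
  rw [descWord_succ, descWord_succ] at hu
  have hne : s j ≠ s (j + 1) := fun he => by
    have := hs.distinct _ _ (by lia) (by lia) he
    lia
  have hadj := hs.adjacent (i := j) (by lia)
  by_contra h3
  obtain ⟨ω', hω'⟩ := hu.exists_cons_cons_of_absorbs cs hne (by lia) h3 h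
  have hmem : s (j + 1) ∈ descWord s j := by
    rw [hω']
    exact List.mem_cons_self
  obtain ⟨h, hh, he⟩ := mem_descWord.1 hmem
  have := hs.distinct _ _ (by lia) (by lia) he
  lia

theorem commute_of_absorbs_descWord (hs : M.IsSimpleSeq J s k) {i : B} {n : ℕ} (hk : n ≤ k + 1)
    (hi : ∀ h ≤ k, s h ≠ i) (habs : cs.Absorbs J i (cs.wordProd (descWord s n))) :
    ∀ h < n, M i (s h) = 2 := by
  induction n with
  | zero => intro h hh; lia
  | succ n ih =>
    have hn2 : M i (s n) = 2 := by
      by_contra h2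
      have hu := ((cs.isChainWord_descWord hs hk).spec cs).1
      rw [descWord_succ] at hu habs
      obtain ⟨ω', hω'⟩ := hu.exists_cons_of_absorbs cs (hi n (by lia)).symm h2 habs
      have hmem : i ∈ descWord s n := by
        rw [hω']
        exact List.mem_cons_self
      obtain ⟨h, hh, he⟩ := mem_descWord.1 hmem
      exact hi h (by lia) he
    intro h hh
    rcases Nat.lt_or_eq_of_le (Nat.le_of_lt_succ hh) with hh | rfl
    · rw [descWord_succ, cs.absorbs_cons_iff_of_commute hn2] at habs
      exact ih (by lia) habs h hh
    · exact hn2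

theorem IsChainWord.suffix_cases {i : B} {ω υ : List B} (h : cs.IsChainWord J (i :: ω))
    (hυ : υ <:+ ω) (hne : υ ≠ ω) :
    υ.head? = some i ∨ cs.Absorbs J i (cs.wordProd υ) ∨ i :: υ <:+ ω := by
  cases h with
  | cons _ _ _ _ _ h => exact h υ hυ hne

theorem IsChainWord.not_absorbs {i : B} {ω : List B} (h : cs.IsChainWord J (i :: ω)) :
    ¬ cs.Absorbs J i (cs.wordProd ω) := by
  cases h with
  | cons _ _ _ _ h _ => exact h

theorem IsChainWord.head_ne {i a : B} {ω : List B} (h : cs.IsChainWord J (i :: a :: ω)) :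
    i ≠ a := by
  cases h with
  | cons _ _ _ h _ _ =>
    rintro rfl
    exact h rfl

/-- A letter absent from `ω` must be absorbed by every proper suffix. If the descending word were a
proper suffix, `i` would commute with all letters and be absorbed by `ω` itself. So `ω` is the
descending word, and the suffixes force `i ∈ J`, joined only to the top generator `s k`. -/
theorem IsChainWord.isFormWord_of_new_letter {i : B} {ω : List B} (hs : M.IsSimpleSeq J s k)
    (hsuf : descWord s (k + 1) <:+ ω) (hmem : ∀ a ∈ ω, ∃ h ≤ k, s h = a)
    (h : cs.IsChainWord J (i :: ω)) (hi : ∀ h ≤ k, s h ≠ i) : M.IsFormWord J (i :: ω) := by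
  have hiω : i ∉ ω := fun hm => by
    obtain ⟨n, hn, he⟩ := hmem i hm
    exact hi n hn he
  have hcases : ∀ υ, υ <:+ ω → υ ≠ ω → cs.Absorbs J i (cs.wordProd υ) := by
    intro υ hυ hne
    rcases h.suffix_cases cs hυ hne with h | h | h
    · exact absurd (hυ.subset (List.mem_of_mem_head? h)) hiω
    · exact h
    · exact absurd (h.subset List.mem_cons_self) hiω
  have hω : descWord s (k + 1) = ω := by
    by_contra hne
    have hc := cs.commute_of_absorbs_descWord hs le_rfl hi (hcases _ hsuf hne)
    have habs := hcases [] List.nil_suffix (by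
      rintro rfl
      exact hne (List.suffix_nil.1 hsuf))
    apply h.not_absorbs cs
    rw [← List.append_nil ω, absorbs_append_iff_of_commute]
    · exact habs
    · intro a ha
      obtain ⟨n, hn, rfl⟩ := hmem a ha
      exact hc n (by lia)
  subst hω
  have hJ : i ∈ J := by
    rw [← cs.absorbs_nil_iff]
    apply hcases [] List.nil_suffix
    rw [descWord_succ]
    exact (List.cons_ne_nil _ _).symm
  have hcomm : ∀ h < k, M i (s h) = 2 := by
    apply cs.commute_of_absorbs_descWord hs (by lia) hi
    apply hcases _ (descWord_isSuffix k.le_succ)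
    rw [descWord_succ]
    exact (List.cons_ne_self _ _).symm
  have hedge : M i (s k) ≠ 2 := by
    intro h2
    apply h.not_absorbs cs
    rw [← List.append_nil (descWord s (k + 1)), absorbs_append_iff_of_commute]
    · exact cs.absorbs_nil_iff.2 hJ
    · intro a ha
      obtain ⟨n, hn, rfl⟩ := mem_descWord.1 ha
      rcases Nat.lt_or_eq_of_le (Nat.le_of_lt_succ hn) with hn | rfl
      · exact hcomm n hn
      · exact h2
  set s' := Function.update s (k + 1) i with hs'
  have hlast : s' (k + 1) = i := by simp [hs']
  have hold : ∀ n ≤ k, s n = s' n := fun n hn => by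
    rw [hs', Function.update_of_ne (by lia)]
  rw [isFormWord_iff]
  refine Or.inl ⟨k + 1, s', (hs.congr hold).succ ?_ ?_ ?_ ?_, ?_⟩
  · rwa [hlast]
  · intro n hn
    rw [hlast, ← hold n hn]
    exact hi n hn
  · intro n hn
    rw [hlast, ← hold n hn.le, M.symmetric]
    exact hcomm n hn
  · rwa [hlast, ← hold k le_rfl, M.symmetric]
  · rw [descWord_succ (k + 1), hlast, descWord_congr (s' := s') fun n hn => hold n (by lia)]

theorem IsChainWord.label_eq_three {ω : List B} (hs : M.IsSimpleSeq J s k) {j : ℕ} (hj : j < k)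
    (hsuf : descWord s (k + 1) <:+ ω) (hne : descWord s (k + 1) ≠ ω)
    (h : cs.IsChainWord J (s j :: ω)) (hnot : ¬ s j :: descWord s (k + 1) <:+ ω) :
    M (s j) (s (j + 1)) = 3 := by
  rcases h.suffix_cases cs hsuf hne with h | h | h
  · rw [descWord_succ, List.head?_cons, Option.some_inj] at h
    have := hs.distinct _ _ (by lia) (by lia) h
    lia
  · exact cs.label_eq_three_of_absorbs_descWord hs (by lia) le_rfl h
  · exact absurd h hnot

/-- For an old letter `s j`, label 3 between `s j` and `s (j + 1)` is excluded, as `ω` would absorb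
it. For `j + 1 < k` the word without its top letter forces that very label, so only the turn back to
`s (k - 1)` remains, with label at least 4. -/
theorem IsChainWord.isFormWord_cons_descWord {i : B} (hs : M.IsSimpleSeq J s k)
    (h : cs.IsChainWord J (i :: descWord s (k + 1))) :
    M.IsFormWord J (i :: descWord s (k + 1)) := by
  by_cases hnew : ∀ n ≤ k, s n ≠ i
  · refine h.isFormWord_of_new_letter cs hs List.suffix_rfl (fun a ha => ?_) hnew
    obtain ⟨n, hn, he⟩ := mem_descWord.1 ha
    exact ⟨n, by lia, he⟩
  push Not at hnew
  obtain ⟨j, hj, rfl⟩ := hnew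
  have hjk : j ≠ k := by
    rintro rfl
    rw [descWord_succ] at h
    exact h.head_ne cs rfl
  have h3 : M (s j) (s (j + 1)) ≠ 3 := fun h3 =>
    h.not_absorbs cs (cs.absorbs_descWord_of_label_eq_three hs (by lia) le_rfl h3)
  rcases Nat.lt_or_eq_of_le (show j + 1 ≤ k by lia) with hlt | rfl
  · exfalso
    obtain ⟨k, rfl⟩ := Nat.exists_eq_add_of_le' (show 1 ≤ k by lia)
    have hne : ∀ n ≤ k + 1, n ≠ j → s n ≠ s j := fun n hn hnj he =>
      hnj (hs.distinct _ _ hn (by lia) he)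
    rcases h.suffix_cases cs (descWord_isSuffix (show k + 1 ≤ k + 1 + 1 by lia)) (by
      rw [descWord_succ (k + 1)]
      exact (List.cons_ne_self _ _).symm) with h | h | h
    · rw [descWord_succ, List.head?_cons, Option.some_inj] at h
      exact hne k (by lia) (by lia) h
    · exact h3 (cs.label_eq_three_of_absorbs_descWord hs (by lia) (by lia) h)
    · exact hne (k + 1) le_rfl (by lia)
        (List.head_eq_of_cons_isSuffix (descWord_succ (s := s) (k + 1) ▸ List.suffix_rfl) h)
  · rw [isFormWord_iff]
    refine Or.inr (Or.inr ⟨j, s, 3, hs, le_rfl, ?_, ?_⟩)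
    · have := hs.adjacent (i := j) le_rfl
      rw [M.symmetric]
      lia
    · rw [zigzagWord_succ 2, zigzagWord_two, if_pos (by decide)]

theorem IsChainWord.isFormWord_cons_zigzagWord {i : B} (hs : M.IsSimpleSeq J s (k + 1)) {m : ℕ}
    (hm : 3 ≤ m) (hlt : M (s (k + 1)) (s k) = 0 ∨ m < M (s (k + 1)) (s k))
    (h : cs.IsChainWord J (i :: zigzagWord s k m)) :
    M.IsFormWord J (i :: zigzagWord s k m) := by
  have hsuf : descWord s (k + 2) <:+ zigzagWord s k m := by
    rw [← zigzagWord_two]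
    exact zigzagWord_isSuffix (by lia)
  by_cases hnew : ∀ n ≤ k + 1, s n ≠ i
  · exact h.isFormWord_of_new_letter cs hs hsuf (fun a ha => mem_zigzagWord ha) hnew
  push Not at hnew
  obtain ⟨j, hj, rfl⟩ := hnew
  have hne : ∀ n ≤ k + 1, n ≠ j → s n ≠ s j := fun n hn hnj he =>
    hnj (hs.distinct _ _ hn (by lia) he)
  obtain ⟨m, rfl⟩ := Nat.exists_eq_add_of_le' (show 3 ≤ m by lia)
  rcases Nat.lt_or_ge j k with hjk | hjk
  · have hz3 : s k :: descWord s (k + 2) <:+ zigzagWord s k (m + 3) := by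
      have := zigzagWord_isSuffix (s := s) (k := k) (show 3 ≤ m + 3 by lia)
      rwa [zigzagWord_succ 2, if_pos (by decide), zigzagWord_two] at this
    have h3 : M (s j) (s (j + 1)) = 3 := by
      refine h.label_eq_three cs hs (by lia) hsuf ?_ fun h' =>
        hne k (by lia) (by lia) (List.head_eq_of_cons_isSuffix hz3 h')
      intro he
      have := hz3.length_le
      rw [← he] at this
      simp at this
    rcases Nat.lt_or_eq_of_le (show j + 1 ≤ k by lia) with hlt | rfl
    · exfalso
      apply h.not_absorbs cs
      rw [zigzagWord, absorbs_append_iff_of_commute]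
      · exact cs.absorbs_descWord_of_label_eq_three hs (by lia) (by lia) h3
      · intro a ha
        obtain ⟨n, hn, rfl⟩ := List.getElem_of_mem ha
        rw [length_alternatingWord] at hn
        rw [getElem_alternatingWord _ _ _ _ hn]
        split_ifs
        · exact hs.commute (by lia) (by lia) (by lia)
        · exact hs.commute (by lia) (by lia) (by lia)
    -- Here `m` counts the letters beyond a zigzag of length 3. Only at exactly length 3 can the
    -- word go on down, as a bounce.
    · rcases Nat.eq_zero_or_pos m with rfl | hpos
      · rw [isFormWord_iff]
        refine Or.inr (Or.inl ⟨j + 1, s, j, hs, by lia, hlt, ?_, ?_⟩)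
        · intro i hi hi'
          rw [show i = j by lia]
          exact h3
        · rw [bounceWord_eq_cons (by lia), zigzagWord_three]
      -- The suffix `zigzagWord s (j + 1) 3` breaks the chain condition: its head is not `s j`, it
      -- extends inside the word only by `s (j + 2)`, and absorbing `s j` would need `s j` as its
      -- second letter.
      · exfalso
        obtain ⟨m, rfl⟩ := Nat.exists_eq_add_of_le' hpos
        have hz4 : s (j + 2) :: zigzagWord s (j + 1) 3 <:+ zigzagWord s (j + 1) (m + 1 + 3) := by
          have := zigzagWord_isSuffix (s := s) (k := j + 1) (show 4 ≤ m + 1 + 3 by lia)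
          rwa [zigzagWord_succ 3, if_neg (by decide)] at this
        have hword : zigzagWord s (j + 1) 3 =
            s (j + 1) :: s (j + 1 + 1) :: descWord s (j + 1 + 1) := by
          rw [zigzagWord_succ 2, if_pos (by decide), zigzagWord_two, descWord_succ]
        rcases h.suffix_cases cs ((List.suffix_cons _ _).trans hz4) (by
          intro he
          have := hz4.length_le
          rw [← he] at this
          simp at this) with h' | h' | h'
        · rw [hword, List.head?_cons, Option.some_inj] at h'
          exact hne _ (by lia) (by lia) h'
        · have hu := ((h.of_isSuffix cs
            (((List.suffix_cons _ _).trans hz4).trans (List.suffix_cons _ _))).spec cs).1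
          rw [hword] at hu h'
          obtain ⟨ω', hω'⟩ := hu.exists_cons_of_absorbs cs (hne _ (by lia) (by lia)).symm
            (by lia) h'
          exact hne _ (by lia) (by lia) (List.cons.inj hω').1
        · exact hne _ (by lia) (by lia) (List.head_eq_of_cons_isSuffix hz4 h')
  · have hnext : s j = if Even (m + 3) then s k else s (k + 1) := by
      have hh := h
      rw [zigzagWord_succ (m + 2)] at hh
      have h1 := hh.head_ne cs
      rcases Nat.lt_or_eq_of_le hj with hj' | rfl
      · have hjk' : j = k := by lia
        subst hjk'
        by_cases he : Even m <;> simp [he, Nat.even_add, show ¬ Even 3 by decide] at h1 ⊢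
      · by_cases he : Even m <;> simp [he, Nat.even_add, show ¬ Even 3 by decide] at h1 ⊢
    rw [hnext, ← zigzagWord_succ, isFormWord_iff]
    refine Or.inr (Or.inr ⟨k, s, m + 3 + 1, hs, by lia, ?_, rfl⟩)
    -- One letter short of a full braid side, the next alternating letter is absorbed, so the zigzag
    -- stops there.
    have : M (s (k + 1)) (s k) ≠ m + 3 + 1 := by
      intro hM
      have habs := cs.absorbs_zigzagWord hs hM
      rw [← hnext] at habs
      exact h.not_absorbs cs habs
    lia

theorem IsChainWord.isFormWord_cons_bounceWord {i : B} (hs : M.IsSimpleSeq J s (k + 1)) {l : ℕ}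
    (hl : l < k) (h4 : M (s (k + 1)) (s k) = 0 ∨ 4 ≤ M (s (k + 1)) (s k))
    (h3 : ∀ i, l ≤ i → i < k → M (s i) (s (i + 1)) = 3)
    (h : cs.IsChainWord J (i :: bounceWord s (k + 1) l)) :
    M.IsFormWord J (i :: bounceWord s (k + 1) l) := by
  have hsuf := descWord_isSuffix_bounceWord (s := s) (k := k + 1) l
  by_cases hnew : ∀ n ≤ k + 1, s n ≠ i
  · exact h.isFormWord_of_new_letter cs hs hsuf (fun a ha => mem_bounceWord ha) hnew
  push Not at hnew
  obtain ⟨j, hj, rfl⟩ := hnew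
  have hne : ∀ n ≤ k + 1, n ≠ j → s n ≠ s j := fun n hn hnj he =>
    hnj (hs.distinct _ _ hn (by lia) he)
  have hcons := bounceWord_eq_cons (s := s) (show l < k + 1 by lia)
  have hjl : j ≠ l := by
    rintro rfl
    rw [hcons] at h
    exact h.head_ne cs rfl
  rcases Nat.lt_or_gt_of_ne hjl with hjl | hjl
  · have hz : s k :: descWord s (k + 2) <:+ bounceWord s (k + 1) l := by
      have h1 : bounceWord s (k + 1) k <:+ bounceWord s (k + 1) l := by
        clear * - hl
        induction hl.le using Nat.decreasingInduction with
        | self => exact List.suffix_rfl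
        | of_succ n hn ih =>
          rw [bounceWord_eq_cons (show n < k + 1 by lia)]
          rcases Nat.lt_or_eq_of_le hn with hn' | hn'
          · exact (ih hn').trans (List.suffix_cons _ _)
          · rw [show n + 1 = k from hn']
            exact List.suffix_cons _ _
      rwa [bounceWord_eq_cons k.lt_succ_self, bounceWord_self] at h1
    have hj3 : M (s j) (s (j + 1)) = 3 := by
      refine h.label_eq_three cs hs (by lia) hsuf ?_ fun h' =>
        hne k (by lia) (by lia) (List.head_eq_of_cons_isSuffix hz h')
      intro he
      have := hz.length_le
      rw [← he] at this
      simp at this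
    rcases Nat.lt_or_eq_of_le (show j + 1 ≤ l by lia) with hlt | rfl
    · exact absurd (cs.absorbs_bounceWord_of_lt hs hlt (by lia) hj3) (h.not_absorbs cs)
    · rw [isFormWord_iff]
      refine Or.inr (Or.inl ⟨k, s, j, hs, by lia, h4, ?_, ?_⟩)
      · intro i hi hi'
        rcases Nat.lt_or_eq_of_le hi with hi | rfl
        · exact h3 i hi hi'
        · exact hj3
      · rw [bounceWord_eq_cons (show j < k + 1 by lia)]
  · exfalso
    apply h.not_absorbs cs
    rcases Nat.lt_or_eq_of_le hj with hj | rfl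
    · obtain ⟨j, rfl⟩ := Nat.exists_eq_add_of_le' (show 1 ≤ j by lia)
      exact cs.absorbs_bounceWord_of_le hs (by lia) (by lia) (h3 j (by lia) (by lia))
    -- The top letter `s (k + 1)` commutes with the leading `s l`, so its absorption by `ω` follows
    -- from the chain condition at the suffix without that letter.
    · rw [hcons, cs.absorbs_cons_iff_of_commute (hs.commute (by lia) (by lia) (by lia))]
      rcases h.suffix_cases cs (hcons ▸ List.suffix_cons _ _) (by
        rw [hcons]
        exact (List.cons_ne_self _ _).symm) with h' | h' | h'
      · rw [bounceWord_eq_cons (by lia), List.head?_cons, Option.some_inj] at h'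
        exact absurd h' (hne _ (by lia) (by lia))
      · exact h'
      · exact absurd (List.head_eq_of_cons_isSuffix (hcons ▸ List.suffix_rfl) h')
          (hne l (by lia) (by lia))

theorem IsChainWord.isFormWord {ω : List B} (h : cs.IsChainWord J ω) (hne : ω ≠ []) :
    M.IsFormWord J ω := by
  induction ω with
  | nil => exact absurd rfl hne
  | cons i ω ih =>
    rcases eq_or_ne ω [] with rfl | hω
    · have hi : i ∉ J := fun hi => h.not_absorbs cs (cs.absorbs_nil_iff.2 hi)
      rw [isFormWord_iff]
      refine Or.inl ⟨0, fun _ => i, ⟨?_, hi, ?_, ?_⟩, by simp [descWord_succ, descWord_zero]⟩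
      · intro a b _ _ _
        lia
      · intro a _ _
        lia
      · intro a b _ _
        rw [← Nat.cast_ofNat (n := 3), natCast_le_label_iff, M.diagonal]
        lia
    · rcases isFormWord_iff.1 (ih (h.of_isSuffix cs (List.suffix_cons i ω)) hω) with
        ⟨k, s, hs, rfl⟩ | ⟨k, s, l, hs, hl, h4, h3, rfl⟩ | ⟨k, s, m, hs, hm, hlt, rfl⟩
      · exact h.isFormWord_cons_descWord cs hs
      · exact h.isFormWord_cons_bounceWord cs hs hl h4 h3
      · exact h.isFormWord_cons_zigzagWord cs hs hm hlt

end CoxeterSystem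

theorem mainTheorem5 {B W : Type*} [Group W] {M : CoxeterMatrix B} (cs : CoxeterSystem M W)
    (J : Set B) :
    (∀ w : W, w ∈ cs.chainlikes J ↔ ∃ ω : List B, M.IsFormWord J ω ∧ cs.wordProd ω = w) ∧
    (∀ ω : List B, M.IsFormWord J ω →
      cs.IsReduced ω ∧
      ∀ ω' : List B, cs.IsReduced ω' → cs.wordProd ω' = cs.wordProd ω → ω' = ω) := by
  refine ⟨fun w => ?_, fun ω hω => ((cs.isChainWord_of_isFormWord hω).2.spec cs).1⟩
  rw [cs.mem_chainlikes_iff]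
  constructor
  · rintro ⟨ω, hne, hω, rfl⟩
    exact ⟨ω, hω.isFormWord cs hne, rfl⟩
  · rintro ⟨ω, hω, rfl⟩
    obtain ⟨hne, hω⟩ := cs.isChainWord_of_isFormWord hω
    exact ⟨ω, hne, hω, rfl⟩
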